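/- Let $n\ge 1$ and, for $0<s\le 1$ and $t>0$, let $$P_t(x)=P(x,t;s)=(2\pi)^{-n}\int_{\mathbb R^n}e^{ix\cdot\xi}\,e^{-t|\xi|^{2s}}\,d\xi$$ be the fundamental solution of $\partial_t u+(-\Delta)^s u=0$ in $\mathbb R^n$. For $u_0\in L^1(\mathbb R^n)$ put $M=\int_{\mathbb R^n}u_0\,dx$, and let $u(x,t)=\int_{\mathbb R^n} P_t(x-y)\,u_0(y)\,dy$ be the solution with initial datum $u_0$. (a) Let $0<s<1$. There is a constant $C=C(n,s)>0$ such that for every $R>0$ there is a time $T=T(n,s,R)>0$ with the following property: for every $u_0\in L^1(\mathbb R^n)$, of any sign, that vanishes almost everywhere outside the ball $B_R(0)$ of radius $R$ centred at the origin, and for every $t\ge T$, one has $P_t>0$ everywhere and $$\frac{|u(x,t)-M P_t(x)|}{P_t(x)}\le C\,\|u_0\|_{L^1(\mathbb R^n)}\,R\,t^{-1/2s}\qquad\text{for all }x\in\mathbb R^n .$$ In particular, if $u_0\ge 0$, the bound is $C\,M\,R\,t^{-1/2s}$. The same bound (with $\|u_0\|_{L^1}$) holds, for almost every $x$, for every weak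 solution $u\in C([0,\infty);L^1(\mathbb R^n))$ with $u(\cdot,0)=u_0$, that is, with $$\int u(x,t)\varphi(x)\,dx=\int u_0(x)\varphi(x)\,dx-\int_0^t\!\!\int u(x,\tau)\,(-\Delta)^s\varphi(x)\,dx\,d\tau$$ for all $t\ge0$ and all $\varphi\in C_c^\infty(\mathbb R^n)$, where $(-\Delta)^s$ has Fourier symbol $|\xi|^{2s}$. (b) Let $s=1$ (the Gaussian case). Then there is no such bound: for every $h\ne 0$ and every $t>0$ the relative error of the translate $u(x,t)=P_t(x-h)$ (with $M=1$) is unbounded in $x$; and likewise, for every $u_0\in L^1(\mathbb R^n)$ with $u_0\ge 0$, $M>0$ and support in some ball $B_R(0)$, the function $|u(x,t)-MP_t(x)|/P_t(x)$ is unbounded in $x$ for every $t>0$. -/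

import Mathlib

open MeasureTheory Filter Topology
open scoped FourierTransform

noncomputable section

/-- The fundamental solution `P(x,t;s)` of `∂ₜu + (-Δ)^s u = 0` on `ℝⁿ`: the inverse Fourier
transform of `exp (-t |ξ|^{2s})`.  Mathlib's transform uses the character `exp (2πi⟪x,ξ⟫)`, so the
frequency `ξ` of the usual (angular) convention is `2πξ` here; for `s = 1` this gives the Gaussian
`(4πt)^{-n/2} exp (-|x|²/4t)`.  The symbol is real and even, so the transform is real. -/
def heatKernel {n : ℕ} (s t : ℝ) (x : EuclideanSpace ℝ (Fin n)) : ℝ :=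
  (𝓕⁻ (fun ξ : EuclideanSpace ℝ (Fin n) =>
    ((Real.exp (-(t * (2 * Real.pi * ‖ξ‖) ^ (2 * s))) : ℝ) : ℂ)) x).re

/-- The solution given by the representation formula `u(x,t) = ∫ P(x-y,t;s) u₀(y) dy`. -/
def heatSolution {n : ℕ} (s : ℝ) (u₀ : EuclideanSpace ℝ (Fin n) → ℝ) (t : ℝ)
    (x : EuclideanSpace ℝ (Fin n)) : ℝ :=
  ∫ y, heatKernel s t (x - y) * u₀ y

/-- The fractional Laplacian `(-Δ)^s φ` of a test function, through its Fourier symbol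
`|ξ|^{2s}`.  For real `φ` the result is real. -/
def fracLaplacian {n : ℕ} (s : ℝ) (φ : EuclideanSpace ℝ (Fin n) → ℝ)
    (x : EuclideanSpace ℝ (Fin n)) : ℝ :=
  (𝓕⁻ (fun ξ : EuclideanSpace ℝ (Fin n) =>
    (((2 * Real.pi * ‖ξ‖) ^ (2 * s) : ℝ) : ℂ) *
      𝓕 (fun y : EuclideanSpace ℝ (Fin n) => ((φ y : ℝ) : ℂ)) ξ) x).re

/-- `u` is a weak solution of `∂ₜu + (-Δ)^s u = 0` in `ℝⁿ × (0,∞)`, in the class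
`C([0,∞); L¹(ℝⁿ))`, with initial datum `u₀`: the equation holds when tested with every smooth,
compactly supported `φ`. -/
structure IsWeakSolution {n : ℕ} (s : ℝ) (u₀ : EuclideanSpace ℝ (Fin n) → ℝ)
    (u : ℝ → EuclideanSpace ℝ (Fin n) → ℝ) : Prop where
  integrable : ∀ t : ℝ, 0 ≤ t → Integrable (u t)
  continuous_L1 : ∀ t : ℝ, 0 ≤ t →
    Tendsto (fun τ : ℝ => ∫ x, |u τ x - u t x|) (𝓝[Set.Ici 0] t) (𝓝 0)
  initial : u 0 =ᵐ[volume] u₀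
  weak : ∀ φ : EuclideanSpace ℝ (Fin n) → ℝ, ContDiff ℝ (⊤ : ℕ∞) φ → HasCompactSupport φ →
    ∀ t : ℝ, 0 ≤ t →
      ∫ x, u t x * φ x =
        (∫ x, u₀ x * φ x) - ∫ τ in (0 : ℝ)..t, ∫ x, u τ x * fracLaplacian s φ x

/-- The relative error `|v(x) - M P_t(x)| / P_t(x)` of a profile `v` at time `t`. -/
def relError {n : ℕ} (s M t : ℝ) (v : EuclideanSpace ℝ (Fin n) → ℝ)
    (x : EuclideanSpace ℝ (Fin n)) : ℝ :=
  |v x - M * heatKernel s t x| / heatKernel s t x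

end

/-
For `s < 1` the fractional kernel is a mixture of Gaussians over a one-sided stable law, whose
tails are polynomial. Hence the logarithm of the kernel is globally Lipschitz at scale `t^{1/2s}`,
and translating the kernel by `y` changes it by a relative error of order `‖y‖ t^{-1/2s}`,
uniformly in `x`; averaging against `u₀` gives (a). The logarithm of the Gaussian is quadratic, so
`P_t(x - y) / P_t(x)` grows exponentially along the direction of `y`, which gives (b). Weak
solutions reduce to the representation formula: testing with truncated plane waves and removing
the truncation yields an ordinary differential equation in time for the Fourier transform.
-/

section LaplaceTransform

open Real Set

lemma exists_integral_rpow_eq_of_tendsto {ν : ℕ → ProbabilityMeasure unitInterval} {φ : ℝ → ℝ}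
    (hν : ∀ l : ℝ, 0 < l →
      Tendsto (fun N => ∫ q, (q : ℝ) ^ l ∂(ν N : Measure unitInterval)) atTop (𝓝 (φ l))) :
    ∃ μ : ProbabilityMeasure unitInterval, ∀ l : ℝ, 0 < l →
      ∫ q, (q : ℝ) ^ l ∂(μ : Measure unitInterval) = φ l := by
  -- the space of probability measures on a compact space is compact, so ultrafilters converge
  have hμ : Tendsto ν (hyperfilter ℕ) (𝓝 ((hyperfilter ℕ).map ν).lim) :=
    ((hyperfilter ℕ).map ν).le_nhds_lim
  refine ⟨((hyperfilter ℕ).map ν).lim, fun l hl => ?_⟩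
  have hcont : Continuous fun q : unitInterval => (q : ℝ) ^ l :=
    continuous_subtype_val.rpow_const fun _ => Or.inr hl.le
  have hlim := ProbabilityMeasure.tendsto_iff_forall_integral_tendsto.1 hμ
    (BoundedContinuousFunction.mkOfCompact ⟨_, hcont⟩)
  refine tendsto_nhds_unique hlim ((hν l hl).mono_left ?_)
  rw [← Nat.cofinite_eq_atTop]
  exact hyperfilter_le_cofinite

lemma ae_ne_zero_of_tendsto_integral_rpow {μ : Measure unitInterval} [IsProbabilityMeasure μ]
    (hμ : Tendsto (fun l : ℝ => ∫ q, (q : ℝ) ^ l ∂μ) (𝓝[>] 0) (𝓝 1)) : ∀ᵐ q ∂μ, q ≠ 0 := by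
  have hlim : Tendsto (fun l : ℝ => ∫ q, (q : ℝ) ^ l ∂μ) (𝓝[>] 0)
      (𝓝 (∫ q, ({0}ᶜ : Set unitInterval).indicator (fun _ => (1 : ℝ)) q ∂μ)) := by
    refine tendsto_integral_filter_of_dominated_convergence (fun _ => 1)
      (Eventually.of_forall fun l => Measurable.aestronglyMeasurable (by fun_prop)) ?_
      (integrable_const _) (ae_of_all _ fun q => ?_)
    · filter_upwards [self_mem_nhdsWithin] with l hl
      refine ae_of_all _ fun q => ?_
      rw [norm_of_nonneg (rpow_nonneg q.2.1 _)]
      exact rpow_le_one q.2.1 q.2.2 (le_of_lt hl)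
    · by_cases hq : q = 0
      · rw [indicator_of_notMem (by simpa using hq), hq]
        refine tendsto_const_nhds.congr' ?_
        filter_upwards [self_mem_nhdsWithin] with l hl
        exact (zero_rpow (ne_of_gt hl)).symm
      · rw [indicator_of_mem (by simpa using hq), ← rpow_zero (q : ℝ)]
        exact (continuousAt_const_rpow fun h => hq (Subtype.ext h)).tendsto.mono_left
          nhdsWithin_le_nhds
  have hone := tendsto_nhds_unique hlim hμ
  rwa [integral_indicator_const _ (measurableSet_singleton _).compl, smul_eq_mul, mul_one,
    probReal_compl_eq_one_sub (measurableSet_singleton _), sub_eq_self, measureReal_eq_zero_iff,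
    measure_eq_zero_iff_ae_notMem] at hone

/-- The map `x ↦ exp (-x)` from `[0, ∞)` to the unit interval, extended to the line by the value `1`
on negative numbers.  It turns Laplace transforms into moments on a compact space. -/
noncomputable def expNeg (x : ℝ) : unitInterval :=
  ⟨exp (-max x 0), (exp_pos _).le, exp_le_one_iff.2 (neg_nonpos.2 (le_max_right _ _))⟩

lemma measurable_expNeg : Measurable expNeg :=
  Measurable.subtype_mk (by fun_prop)

lemma integral_rpow_map_expNeg {μ : Measure ℝ} (hμ : ∀ᵐ x ∂μ, 0 ≤ x) {l : ℝ} (hl : 0 ≤ l) :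
    ∫ q, (q : ℝ) ^ l ∂μ.map expNeg = ∫ x, exp (-(l * x)) ∂μ := by
  have hcont : Continuous fun q : unitInterval => (q : ℝ) ^ l :=
    continuous_subtype_val.rpow_const fun _ => Or.inr hl
  rw [integral_map measurable_expNeg.aemeasurable hcont.aestronglyMeasurable]
  refine integral_congr_ae ?_
  filter_upwards [hμ] with x hx
  change exp (-max x 0) ^ l = _
  rw [max_eq_left hx, ← exp_mul, neg_mul, mul_comm]

lemma exists_laplace_eq_of_tendsto {ν : ℕ → Measure ℝ} [∀ N, IsProbabilityMeasure (ν N)]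
    (hν : ∀ N, ∀ᵐ x ∂ν N, 0 ≤ x) {φ : ℝ → ℝ}
    (hlim : ∀ l : ℝ, 0 < l → Tendsto (fun N => ∫ x, exp (-(l * x)) ∂ν N) atTop (𝓝 (φ l)))
    (hφ : Tendsto φ (𝓝[>] 0) (𝓝 1)) :
    ∃ μ : Measure ℝ, IsProbabilityMeasure μ ∧ (∀ᵐ x ∂μ, 0 ≤ x) ∧
      ∀ l : ℝ, 0 < l → ∫ x, exp (-(l * x)) ∂μ = φ l := by
  let ρ : ℕ → ProbabilityMeasure unitInterval := fun N =>
    ⟨(ν N).map expNeg, Measure.isProbabilityMeasure_map measurable_expNeg.aemeasurable⟩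
  obtain ⟨κ, hκ⟩ := exists_integral_rpow_eq_of_tendsto (ν := ρ) (φ := φ) fun l hl =>
    (hlim l hl).congr fun N => (integral_rpow_map_expNeg (hν N) hl.le).symm
  have hne : ∀ᵐ q ∂(κ : Measure unitInterval), q ≠ 0 :=
    ae_ne_zero_of_tendsto_integral_rpow
      (hφ.congr' (eventually_nhdsWithin_of_forall fun l hl => (hκ l hl).symm))
  have hlog : Measurable fun q : unitInterval => -log (q : ℝ) := by fun_prop
  refine ⟨(κ : Measure unitInterval).map fun q : unitInterval => -log (q : ℝ),
    Measure.isProbabilityMeasure_map hlog.aemeasurable, ?_, fun l hl => ?_⟩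
  · rw [ae_map_iff hlog.aemeasurable measurableSet_Ici]
    exact ae_of_all _ fun q => neg_nonneg.2 (log_nonpos q.2.1 q.2.2)
  · rw [integral_map hlog.aemeasurable (Measurable.aestronglyMeasurable (by fun_prop)), ← hκ l hl]
    refine integral_congr_ae ?_
    filter_upwards [hne] with q hq
    rw [rpow_def_of_pos (unitInterval.pos_iff_ne_zero.2 hq), mul_neg, neg_neg, mul_comm]

lemma integrable_exp_neg_mul {μ : Measure ℝ} [IsFiniteMeasure μ] (hμ : ∀ᵐ x ∂μ, 0 ≤ x) {l : ℝ}
    (hl : 0 ≤ l) : Integrable (fun x => exp (-(l * x))) μ := by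
  refine Integrable.of_bound (C := 1) (by fun_prop) ?_
  filter_upwards [hμ] with x hx
  rw [norm_of_nonneg (exp_pos _).le, exp_le_one_iff, neg_nonpos]
  positivity

lemma ae_pos_of_tendsto_laplace {μ : Measure ℝ} [IsFiniteMeasure μ] (hμ : ∀ᵐ x ∂μ, 0 ≤ x)
    (hlim : Tendsto (fun l : ℝ => ∫ x, exp (-(l * x)) ∂μ) atTop (𝓝 0)) : ∀ᵐ x ∂μ, 0 < x := by
  have hle : ∀ᶠ l : ℝ in atTop, μ.real {0} ≤ ∫ x, exp (-(l * x)) ∂μ := by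
    filter_upwards [eventually_ge_atTop 0] with l hl
    rw [← integral_indicator_one (measurableSet_singleton _)]
    exact integral_mono ((integrable_const _).indicator (measurableSet_singleton _))
      (integrable_exp_neg_mul hμ hl)
      (indicator_le' (fun x hx => by simp [mem_singleton_iff.1 hx]) fun _ _ => (exp_pos _).le)
  have hzero : μ.real {0} = 0 := le_antisymm (ge_of_tendsto hlim hle) measureReal_nonneg
  rw [measureReal_eq_zero_iff, measure_eq_zero_iff_ae_notMem] at hzero
  filter_upwards [hμ, hzero] with x hx hx0
  exact lt_of_le_of_ne hx (Ne.symm hx0)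

lemma integral_exp_neg_mul_sum_pi (μ : Measure ℝ) [SigmaFinite μ] (N : ℕ) (l : ℝ) :
    ∫ x, exp (-(l * ∑ i, x i)) ∂(Measure.pi fun _ : Fin N => μ) = (∫ x, exp (-(l * x)) ∂μ) ^ N := by
  simp_rw [Finset.mul_sum, ← Finset.sum_neg_distrib, exp_sum]
  rw [integral_fintype_prod_eq_pow fun x => exp (-(l * x)), Fintype.card_fin]

end LaplaceTransform

section Pareto

open Real Set ProbabilityTheory

lemma integral_paretoMeasure {t r : ℝ} (ht : 0 ≤ t) (hr : 0 ≤ r) (f : ℝ → ℝ) :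
    ∫ x, f x ∂paretoMeasure t r = ∫ x in Ioi t, r * t ^ r * x ^ (-(r + 1)) * f x := by
  have hmeas : Measurable (paretoPDF t r) := (measurable_paretoPDFReal t r).ennreal_ofReal
  rw [paretoMeasure, integral_withDensity_eq_integral_toReal_smul hmeas
    (ae_of_all _ fun x => ENNReal.ofReal_lt_top), ← integral_Ici_eq_integral_Ioi,
    ← integral_indicator measurableSet_Ici]
  congr 1 with x
  by_cases hx : t ≤ x
  · have hx0 : 0 ≤ x := ht.trans hx
    rw [indicator_of_mem (by exact hx), paretoPDF_of_le hx, ENNReal.toReal_ofReal (by positivity),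
      smul_eq_mul]
  · rw [indicator_of_notMem (by simpa using hx), paretoPDF_of_lt (not_le.1 hx),
      ENNReal.toReal_zero, zero_smul]

lemma ae_le_paretoMeasure (t r : ℝ) : ∀ᵐ x ∂paretoMeasure t r, t ≤ x := by
  have hcompl : {x : ℝ | ¬ t ≤ x} = Iio t := by ext; simp
  rw [ae_iff, hcompl, paretoMeasure, withDensity_apply _ measurableSet_Iio]
  exact lintegral_paretoPDF_of_le le_rfl

lemma integrableOn_one_sub_exp_neg_mul_rpow {s : ℝ} (hs0 : 0 < s) (hs1 : s < 1) :
    IntegrableOn (fun u : ℝ => (1 - exp (-u)) * u ^ (-(s + 1))) (Ioi 0) := by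
  have hmeas : Measurable fun u : ℝ => (1 - exp (-u)) * u ^ (-(s + 1)) := by fun_prop
  have hnonneg : ∀ u : ℝ, 0 ≤ u → 0 ≤ 1 - exp (-u) := fun u hu =>
    sub_nonneg.2 (exp_le_one_iff.2 (neg_nonpos.2 hu))
  rw [← Ioc_union_Ioi_eq_Ioi (zero_le_one' ℝ)]
  refine IntegrableOn.union ?_ ?_
  · have hint : IntegrableOn (fun u : ℝ => u ^ (-s)) (Ioc 0 1) := by
      rw [← intervalIntegrable_iff_integrableOn_Ioc_of_le zero_le_one]
      exact intervalIntegral.intervalIntegrable_rpow' (by linarith)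
    refine Integrable.mono' hint hmeas.aestronglyMeasurable ?_
    refine (ae_restrict_mem measurableSet_Ioc).mono fun u hu => ?_
    have hpow := rpow_nonneg hu.1.le (-(s + 1))
    rw [norm_of_nonneg (mul_nonneg (hnonneg u hu.1.le) hpow)]
    calc (1 - exp (-u)) * u ^ (-(s + 1)) ≤ u * u ^ (-(s + 1)) := by
          gcongr; linarith [add_one_le_exp (-u)]
      _ = u ^ (-s) := by rw [← rpow_one_add' hu.1.le (by linarith)]; ring_nf
  · refine Integrable.mono' (integrableOn_Ioi_rpow_of_lt (a := -(s + 1)) (by linarith) one_pos)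
      hmeas.aestronglyMeasurable ?_
    refine (ae_restrict_mem measurableSet_Ioi).mono fun u hu => ?_
    have hu0 : 0 ≤ u := zero_le_one.trans (le_of_lt hu)
    have hpow := rpow_nonneg hu0 (-(s + 1))
    rw [norm_of_nonneg (mul_nonneg (hnonneg u hu0) hpow)]
    exact mul_le_of_le_one_left hpow (by linarith [exp_pos (-u)])

lemma integral_one_sub_exp_neg_mul_rpow_pos {s : ℝ} (hs0 : 0 < s) (hs1 : s < 1) :
    0 < ∫ u in Ioi 0, (1 - exp (-u)) * u ^ (-(s + 1)) := by
  have hpos : ∀ u ∈ Ioi (0 : ℝ), 0 < (1 - exp (-u)) * u ^ (-(s + 1)) := fun u hu =>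
    mul_pos (sub_pos.2 (exp_lt_one_iff.2 (neg_neg_of_pos hu))) (rpow_pos_of_pos hu _)
  rw [setIntegral_pos_iff_support_of_nonneg_ae
    ((ae_restrict_mem measurableSet_Ioi).mono fun u hu => (hpos u hu).le)
    (integrableOn_one_sub_exp_neg_mul_rpow hs0 hs1),
    inter_eq_right.2 fun u hu => Function.mem_support.2 (hpos u hu).ne', volume_Ioi]
  exact ENNReal.zero_lt_top

lemma one_sub_integral_exp_paretoMeasure {s b : ℝ} (hs : 0 < s) (hb : 0 < b) :
    1 - ∫ x, exp (-(b * x)) ∂paretoMeasure 1 s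
      = b ^ s * (s * ∫ u in Ioi b, (1 - exp (-u)) * u ^ (-(s + 1))) := by
  have := isProbabilityMeasure_paretoMeasure one_pos hs
  have hscale : ∫ u in Ioi b, (1 - exp (-u)) * u ^ (-(s + 1))
      = b * ∫ x in Ioi 1, (1 - exp (-(b * x))) * (b * x) ^ (-(s + 1)) := by
    have hsub := integral_comp_mul_left_Ioi (fun u : ℝ => (1 - exp (-u)) * u ^ (-(s + 1))) 1 hb
    rw [mul_one, smul_eq_mul] at hsub
    rw [hsub, mul_inv_cancel_left₀ hb.ne']
  have hpow : b ^ s * b * b ^ (-(s + 1)) = 1 := by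
    rw [← rpow_add_one hb.ne', ← rpow_add hb, add_neg_cancel, rpow_zero]
  calc 1 - ∫ x, exp (-(b * x)) ∂paretoMeasure 1 s
      = ∫ x, (1 - exp (-(b * x))) ∂paretoMeasure 1 s := by
        rw [integral_sub (integrable_const _) (integrable_exp_neg_mul
          ((ae_le_paretoMeasure 1 s).mono fun x hx => zero_le_one.trans hx) hb.le)]
        simp
    _ = ∫ x in Ioi 1, b ^ s * (s * (b * ((1 - exp (-(b * x))) * (b * x) ^ (-(s + 1))))) := by
        rw [integral_paretoMeasure zero_le_one hs.le]
        refine setIntegral_congr_fun measurableSet_Ioi fun x hx => ?_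
        rw [one_rpow, mul_rpow hb.le (zero_le_one.trans (le_of_lt hx))]
        linear_combination (-s * x ^ (-(s + 1)) * (1 - exp (-(b * x)))) * hpow
    _ = _ := by rw [hscale]; simp_rw [integral_const_mul]

lemma tendsto_one_sub_integral_exp_paretoMeasure_div_rpow {s : ℝ} (hs0 : 0 < s) (hs1 : s < 1) :
    Tendsto (fun b : ℝ => (1 - ∫ x, exp (-(b * x)) ∂paretoMeasure 1 s) / b ^ s) (𝓝[>] 0)
      (𝓝 (s * ∫ u in Ioi 0, (1 - exp (-u)) * u ^ (-(s + 1)))) := by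
  have htail := ((aecover_Ioi_of_Ioi (μ := volume) (l := 𝓝[>] (0 : ℝ)) (a := id)
    (tendsto_id.mono_left nhdsWithin_le_nhds)).integral_tendsto_of_countably_generated
      (integrableOn_one_sub_exp_neg_mul_rpow hs0 hs1)).const_mul s
  refine htail.congr' (eventually_nhdsWithin_of_forall fun b hb => ?_)
  simp only [id]
  rw [Measure.restrict_restrict_of_subset (Ioi_subset_Ioi (le_of_lt hb)),
    one_sub_integral_exp_paretoMeasure hs0 hb, mul_div_cancel_left₀ _ (rpow_pos_of_pos hb s).ne']

end Pareto

section StableLaw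

open Real Set ProbabilityTheory

lemma tendsto_mul_mul_natCast_rpow_neg_inv {s K l : ℝ} (hs : 0 < s) (hK : 0 < K) (hl : 0 < l) :
    Tendsto (fun N : ℕ => l * (K * N) ^ (-s⁻¹)) atTop (𝓝[>] 0) := by
  rw [tendsto_nhdsWithin_iff]
  constructor
  · simpa only [mul_zero, Function.comp_def] using ((tendsto_rpow_neg_atTop (inv_pos.2 hs)).comp
      (tendsto_natCast_atTop_atTop.const_mul_atTop hK)).const_mul l
  · filter_upwards [eventually_gt_atTop 0] with N hN
    have : (0 : ℝ) < N := Nat.cast_pos.2 hN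
    exact mem_Ioi.2 (by positivity)

lemma tendsto_pow_exp_of_tendsto_one_sub_div_rpow {F : ℝ → ℝ} {s K l : ℝ} (hs : 0 < s) (hK : 0 < K)
    (hl : 0 < l) (hF : Tendsto (fun b => (1 - F b) / b ^ s) (𝓝[>] 0) (𝓝 K)) :
    Tendsto (fun N : ℕ => F (l * (K * N) ^ (-s⁻¹)) ^ N) atTop (𝓝 (exp (-(l ^ s)))) := by
  set b : ℕ → ℝ := fun N => l * (K * N) ^ (-s⁻¹)
  have hb : ∀ N, b N ^ s = l ^ s * (K * N)⁻¹ := fun N => by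
    rw [mul_rpow hl.le (by positivity), ← rpow_mul (by positivity), neg_mul,
      inv_mul_cancel₀ hs.ne', rpow_neg_one]
  have hdefect : Tendsto (fun N : ℕ => (N : ℝ) * (F (b N) - 1)) atTop (𝓝 (-(l ^ s))) := by
    have hlim := ((hF.comp (tendsto_mul_mul_natCast_rpow_neg_inv hs hK hl)).const_mul
      (l ^ s / K)).neg
    rw [div_mul_cancel₀ _ hK.ne'] at hlim
    refine hlim.congr' ?_
    filter_upwards [eventually_gt_atTop 0] with N hN
    have : (0 : ℝ) < N := Nat.cast_pos.2 hN
    change -(l ^ s / K * ((1 - F (b N)) / b N ^ s)) = _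
    rw [hb]
    field_simp
    ring
  exact (tendsto_one_add_pow_exp_of_tendsto hdefect).congr fun N => by rw [add_sub_cancel]

/-- The one-sided stable law of index `s`: the probability measure on `(0, ∞)` whose Laplace
transform is `exp (-l ^ s)`.  The fractional heat semigroup is the heat semigroup run for a random
time with this law. -/
structure IsStableLaw (s : ℝ) (μ : Measure ℝ) : Prop where
  isProbabilityMeasure : IsProbabilityMeasure μ
  pos : ∀ᵐ τ ∂μ, 0 < τ
  laplace : ∀ l : ℝ, 0 ≤ l → ∫ τ, exp (-(l * τ)) ∂μ = exp (-(l ^ s))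

lemma isStableLaw_of_laplace {s : ℝ} (hs : 0 < s) {μ : Measure ℝ} [IsProbabilityMeasure μ]
    (hμ : ∀ᵐ τ ∂μ, 0 ≤ τ)
    (hlap : ∀ l : ℝ, 0 < l → ∫ τ, exp (-(l * τ)) ∂μ = exp (-(l ^ s))) : IsStableLaw s μ := by
  refine ⟨inferInstance, ae_pos_of_tendsto_laplace hμ ?_, fun l hl => ?_⟩
  · refine (tendsto_exp_neg_atTop_nhds_zero.comp (tendsto_rpow_atTop hs)).congr' ?_
    filter_upwards [eventually_gt_atTop 0] with l hl
    exact (hlap l hl).symm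
  · rcases hl.eq_or_lt with rfl | hl
    · simp [zero_rpow hs.ne']
    · exact hlap l hl

theorem exists_isStableLaw {s : ℝ} (hs0 : 0 < s) (hs1 : s < 1) :
    ∃ μ : Measure ℝ, IsStableLaw s μ := by
  have := isProbabilityMeasure_paretoMeasure one_pos hs0
  set K : ℝ := s * ∫ u in Ioi 0, (1 - exp (-u)) * u ^ (-(s + 1))
  have hK : 0 < K := mul_pos hs0 (integral_one_sub_exp_neg_mul_rpow_pos hs0 hs1)
  -- normalized sums of independent Pareto variables converge in law to the stable law
  let S : (N : ℕ) → (Fin N → ℝ) → ℝ := fun N x => (K * N) ^ (-s⁻¹) * ∑ i, x i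
  have hS : ∀ N, Measurable (S N) := fun N => by fun_prop
  let ν : ℕ → Measure ℝ := fun N => (Measure.pi fun _ : Fin N => paretoMeasure 1 s).map (S N)
  have hνprob : ∀ N, IsProbabilityMeasure (ν N) := fun N =>
    Measure.isProbabilityMeasure_map (hS N).aemeasurable
  have hνnonneg : ∀ N, ∀ᵐ x ∂ν N, 0 ≤ x := fun N => by
    rw [ae_map_iff (hS N).aemeasurable measurableSet_Ici]
    filter_upwards [eventually_all.2 fun i : Fin N =>
      Measure.tendsto_eval_ae_ae.eventually (ae_le_paretoMeasure 1 s)] with x hx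
    have : 0 ≤ ∑ i, x i := Finset.sum_nonneg fun i _ => zero_le_one.trans (hx i)
    positivity
  have hνlap : ∀ l N, ∫ x, exp (-(l * x)) ∂ν N
      = (∫ x, exp (-(l * (K * N) ^ (-s⁻¹) * x)) ∂paretoMeasure 1 s) ^ N := fun l N => by
    rw [integral_map (hS N).aemeasurable (by fun_prop), ← integral_exp_neg_mul_sum_pi]
    simp_rw [S, mul_assoc]
  have hφ : Tendsto (fun l : ℝ => exp (-(l ^ s))) (𝓝[>] 0) (𝓝 1) := by
    have hcont : Continuous fun l : ℝ => exp (-(l ^ s)) := (continuous_rpow_const hs0.le).neg.rexp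
    simpa [zero_rpow hs0.ne'] using (hcont.tendsto 0).mono_left (nhdsWithin_le_nhds (s := Ioi 0))
  obtain ⟨μ, _, hnonneg, hlap⟩ := exists_laplace_eq_of_tendsto hνnonneg (fun l hl =>
    (tendsto_pow_exp_of_tendsto_one_sub_div_rpow hs0 hK hl
      (tendsto_one_sub_integral_exp_paretoMeasure_div_rpow hs0 hs1)).congr
        fun N => (hνlap l N).symm) hφ
  exact ⟨μ, isStableLaw_of_laplace hs0 hnonneg hlap⟩

end StableLaw

section StableTails

open Real Set

lemma half_le_one_sub_exp_neg {x : ℝ} (hx0 : 0 ≤ x) (hx1 : x ≤ 1) : x / 2 ≤ 1 - exp (-x) := by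
  have hinv : exp (-x) ≤ (x + 1)⁻¹ := by
    rw [exp_neg]
    exact inv_anti₀ (by linarith) (add_one_le_exp x)
  have hfrac : (x + 1)⁻¹ ≤ 1 - x / 2 := by
    rw [inv_le_iff_one_le_mul₀ (by linarith)]
    nlinarith
  linarith

lemma half_le_one_sub_exp_neg_of_one_le {x : ℝ} (hx : 1 ≤ x) : 1 / 2 ≤ 1 - exp (-x) :=
  (half_le_one_sub_exp_neg zero_le_one le_rfl).trans
    (sub_le_sub_left (exp_le_exp.2 (neg_le_neg hx)) _)

lemma one_sub_exp_neg_le (x : ℝ) : 1 - exp (-x) ≤ x := by linarith [add_one_le_exp (-x)]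

lemma one_sub_exp_neg_nonneg {x : ℝ} (hx : 0 ≤ x) : 0 ≤ 1 - exp (-x) :=
  sub_nonneg.2 (exp_le_one_iff.2 (neg_nonpos.2 hx))

lemma integrable_one_sub_exp_neg_mul {μ : Measure ℝ} [IsFiniteMeasure μ] (hμ : ∀ᵐ τ ∂μ, 0 ≤ τ)
    {l : ℝ} (hl : 0 ≤ l) : Integrable (fun τ => 1 - exp (-(l * τ))) μ :=
  (integrable_const 1).sub (integrable_exp_neg_mul hμ hl)

lemma measureReal_Ici_le_integral_one_sub_exp {μ : Measure ℝ} [IsFiniteMeasure μ]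
    (hμ : ∀ᵐ τ ∂μ, 0 ≤ τ) {x : ℝ} (hx : 0 < x) :
    μ.real (Ici x) ≤ 2 * ∫ τ, (1 - exp (-(x⁻¹ * τ))) ∂μ := by
  rw [← integral_indicator_one measurableSet_Ici, ← integral_const_mul]
  refine integral_mono_ae ((integrable_const _).indicator measurableSet_Ici)
    ((integrable_one_sub_exp_neg_mul hμ (inv_nonneg.2 hx.le)).const_mul 2) ?_
  filter_upwards [hμ] with τ hτ
  by_cases hτx : x ≤ τ
  · rw [indicator_of_mem (by exact hτx), Pi.one_apply]
    linarith [half_le_one_sub_exp_neg_of_one_le ((one_le_inv_mul₀ hx).2 hτx)]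
  · rw [indicator_of_notMem (by exact hτx)]
    have := one_sub_exp_neg_nonneg (x := x⁻¹ * τ) (by positivity)
    positivity

lemma integral_one_sub_exp_sub_le_measureReal_Ici {μ : Measure ℝ} [IsFiniteMeasure μ]
    (hμ : ∀ᵐ τ ∂μ, 0 ≤ τ) {L x : ℝ} (hL : 0 < L) (hx : 0 < x) :
    (∫ τ, (1 - exp (-((L * x)⁻¹ * τ))) ∂μ) - 2 / L * ∫ τ, (1 - exp (-(x⁻¹ * τ))) ∂μ
      ≤ μ.real (Ici x) := by
  have hint := integrable_one_sub_exp_neg_mul hμ (l := (L * x)⁻¹) (by positivity)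
  have hint' := (integrable_one_sub_exp_neg_mul hμ (l := x⁻¹) (by positivity)).const_mul (2 / L)
  rw [← integral_const_mul, ← integral_sub hint hint', ← integral_indicator_one measurableSet_Ici]
  refine integral_mono_ae (hint.sub hint') ((integrable_const _).indicator measurableSet_Ici) ?_
  filter_upwards [hμ] with τ hτ
  have hscale : (L * x)⁻¹ * τ = x⁻¹ * τ / L := by rw [mul_inv]; ring
  rw [hscale]
  set z := x⁻¹ * τ
  have hz : 0 ≤ z := by positivity
  by_cases hτx : x ≤ τ
  · rw [indicator_of_mem (by exact hτx), Pi.one_apply]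
    have := one_sub_exp_neg_nonneg hz
    have : 0 ≤ 2 / L * (1 - exp (-z)) := by positivity
    linarith [exp_pos (-(z / L))]
  · rw [indicator_of_notMem (by exact hτx), sub_nonpos]
    have hz1 : z ≤ 1 := by
      rw [inv_mul_le_iff₀ hx, mul_one]
      exact (not_le.1 hτx).le
    calc 1 - exp (-(z / L)) ≤ z / L := one_sub_exp_neg_le _
      _ = 2 / L * (z / 2) := by ring
      _ ≤ 2 / L * (1 - exp (-z)) := by gcongr; exact half_le_one_sub_exp_neg hz hz1

namespace IsStableLaw

variable {s : ℝ} {μ : Measure ℝ}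

lemma integrable_exp (h : IsStableLaw s μ) {l : ℝ} (hl : 0 ≤ l) :
    Integrable (fun τ => exp (-(l * τ))) μ := by
  have := h.isProbabilityMeasure
  exact integrable_exp_neg_mul (h.pos.mono fun _ => le_of_lt) hl

lemma integral_one_sub_exp_inv_mul (h : IsStableLaw s μ) {x : ℝ} (hx : 0 ≤ x) :
    ∫ τ, (1 - exp (-(x⁻¹ * τ))) ∂μ = 1 - exp (-(x ^ (-s))) := by
  have := h.isProbabilityMeasure
  rw [integral_sub (integrable_const _) (h.integrable_exp (inv_nonneg.2 hx)),
    h.laplace _ (inv_nonneg.2 hx), inv_rpow hx, rpow_neg hx]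
  simp

lemma measureReal_Ici_le (h : IsStableLaw s μ) {x : ℝ} (hx : 0 < x) :
    μ.real (Ici x) ≤ 2 * x ^ (-s) := by
  have := h.isProbabilityMeasure
  have hle := measureReal_Ici_le_integral_one_sub_exp (h.pos.mono fun _ => le_of_lt) hx
  rw [h.integral_one_sub_exp_inv_mul hx.le] at hle
  linarith [one_sub_exp_neg_le (x ^ (-s))]

lemma le_measureReal_Ici (h : IsStableLaw s μ) (hs : 0 ≤ s) {L x : ℝ} (hL0 : 0 < L)
    (hL : 8 ≤ L ^ (1 - s)) (hx : 0 < x) (hLx : 1 ≤ L * x) :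
    (L * x) ^ (-s) / 4 ≤ μ.real (Ici x) := by
  have := h.isProbabilityMeasure
  have hle := integral_one_sub_exp_sub_le_measureReal_Ici (h.pos.mono fun _ => le_of_lt) hL0 hx
  rw [h.integral_one_sub_exp_inv_mul (by positivity),
    h.integral_one_sub_exp_inv_mul hx.le] at hle
  have hlower := half_le_one_sub_exp_neg (x := (L * x) ^ (-s)) (by positivity)
    (rpow_le_one_of_one_le_of_nonpos hLx (neg_nonpos.2 hs))
  have hupper : 2 / L * (1 - exp (-(x ^ (-s)))) ≤ (L * x) ^ (-s) / 4 :=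
    calc 2 / L * (1 - exp (-(x ^ (-s)))) ≤ 2 / L * x ^ (-s) := by
          gcongr; exact one_sub_exp_neg_le _
      _ = 2 * (L * x) ^ (-s) / L ^ (1 - s) := by
          rw [mul_rpow hL0.le hx.le, sub_eq_add_neg, rpow_add hL0, rpow_one]
          field_simp
      _ ≤ 2 * (L * x) ^ (-s) / 8 := by gcongr
      _ = (L * x) ^ (-s) / 4 := by ring
  linarith

lemma exists_le_measureReal_Ico (h : IsStableLaw s μ) (hs0 : 0 < s) (hs1 : s < 1) :
    ∃ K c : ℝ, 0 < K ∧ 0 < c ∧ ∀ x : ℝ, 1 ≤ x → c * x ^ (-s) ≤ μ.real (Ico x (K * x)) := by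
  have := h.isProbabilityMeasure
  set L : ℝ := 8 ^ (1 - s)⁻¹
  have hL1 : 1 ≤ L := one_le_rpow (by norm_num) (inv_nonneg.2 (sub_nonneg.2 hs1.le))
  have hL : L ^ (1 - s) = 8 := rpow_inv_rpow (by norm_num) (sub_pos.2 hs1).ne'
  set K : ℝ := 16 ^ s⁻¹ * L
  have hK : K ^ (-s) = L ^ (-s) / 16 := by
    rw [mul_rpow (by positivity) (by positivity), rpow_neg (by positivity),
      rpow_inv_rpow (by norm_num) hs0.ne', inv_mul_eq_div]
  refine ⟨K, L ^ (-s) / 8, by positivity, by positivity, fun x hx => ?_⟩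
  have hx0 : 0 < x := one_pos.trans_le hx
  have hlower := h.le_measureReal_Ici hs0.le (by positivity) hL.ge hx0
    (one_le_mul_of_one_le_of_one_le hL1 hx)
  have hupper := h.measureReal_Ici_le (x := K * x) (by positivity)
  rw [mul_rpow (by positivity) hx0.le] at hlower hupper
  rw [hK] at hupper
  have hsub : μ.real (Ici x) ≤ μ.real (Ico x (K * x)) + μ.real (Ici (K * x)) :=
    (measureReal_mono Ici_subset_Ico_union_Ici).trans (measureReal_union_le _ _)
  linarith

end IsStableLaw

end StableTails

section GaussianMixture

open Real Set

lemma rpow_le_mul_exp {z q a : ℝ} (hz : 0 ≤ z) (hq : 0 < q) (ha : 0 < a) :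
    z ^ q ≤ (q / a) ^ q * exp (a * z) := by
  have hexp : a * z / q ≤ exp (a * z / q) := by linarith [add_one_le_exp (a * z / q)]
  calc z ^ q = (q / a) ^ q * (a * z / q) ^ q := by
        rw [← mul_rpow (by positivity) (by positivity)]
        congr 1
        field_simp
    _ ≤ (q / a) ^ q * exp (a * z / q) ^ q := by gcongr
    _ = (q / a) ^ q * exp (a * z) := by rw [← exp_mul, div_mul_cancel₀ _ hq.ne']

/-- The radial profile `r ↦ ∫ τ ^ (-p) exp (-r² / 4τ) dμ(τ)` of a mixture of Gaussians whose
variances are distributed according to `μ`.  With `p = n / 2` this is, up to a constant, the profile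
of the heat kernel on `ℝⁿ` run for a random time with law `μ`. -/
noncomputable def gaussMix (μ : Measure ℝ) (p r : ℝ) : ℝ :=
  ∫ τ, τ ^ (-p) * exp (-(r ^ 2 / (4 * τ))) ∂μ

namespace IsStableLaw

variable {s : ℝ} {μ : Measure ℝ}

lemma integrable_rpow_neg (h : IsStableLaw s μ) (hs : 0 < s) {p : ℝ} (hp : 0 ≤ p) :
    Integrable (fun τ => τ ^ (-p)) μ := by
  have := h.isProbabilityMeasure
  rcases hp.eq_or_lt with rfl | hp
  · simp
  have hprod : Integrable (fun z : ℝ × ℝ => z.2 ^ (p - 1) * exp (-(z.2 * z.1)))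
      (μ.prod (volume.restrict (Ioi 0))) := by
    rw [integrable_prod_iff' (by fun_prop)]
    constructor
    · refine (ae_restrict_mem measurableSet_Ioi).mono fun l hl => ?_
      exact (h.integrable_exp (le_of_lt hl)).const_mul (l ^ (p - 1))
    · refine (integrableOn_rpow_mul_exp_neg_rpow (s := p - 1) (by linarith) hs).congr ?_
      refine (ae_restrict_mem measurableSet_Ioi).mono fun l (hl : 0 < l) => ?_
      simp only [norm_mul, norm_of_nonneg (exp_pos _).le, norm_of_nonneg (rpow_nonneg hl.le _)]
      rw [integral_const_mul, h.laplace l hl.le]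
  refine (hprod.integral_prod_left.const_mul (Gamma p)⁻¹).congr ?_
  filter_upwards [h.pos] with τ hτ
  simp_rw [mul_comm _ τ]
  rw [integral_rpow_mul_exp_neg_mul_Ioi hp hτ, rpow_neg hτ.le, one_div, inv_rpow hτ.le,
    mul_comm, mul_assoc, mul_inv_cancel₀ (Gamma_pos_of_pos hp).ne', mul_one]

lemma integrable_rpow_neg_mul_exp (h : IsStableLaw s μ) (hs : 0 < s) {p : ℝ} (hp : 0 ≤ p)
    (r : ℝ) : Integrable (fun τ => τ ^ (-p) * exp (-(r ^ 2 / (4 * τ)))) μ := by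
  refine (h.integrable_rpow_neg hs hp).mono (by fun_prop) ?_
  filter_upwards [h.pos] with τ hτ
  rw [norm_mul, norm_of_nonneg (exp_pos _).le]
  exact mul_le_of_le_one_right (norm_nonneg _) (exp_le_one_iff.2 (neg_nonpos.2 (by positivity)))

lemma exists_le_gaussMix (h : IsStableLaw s μ) (hs0 : 0 < s) (hs1 : s < 1) {p : ℝ} (hp : 0 ≤ p) :
    ∃ c : ℝ, 0 < c ∧ ∀ r : ℝ, 0 ≤ r → c * (1 + r) ^ (-(2 * (p + s))) ≤ gaussMix μ p r := by
  have := h.isProbabilityMeasure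
  obtain ⟨K, c, hK, hc, hmass⟩ := h.exists_le_measureReal_Ico hs0 hs1
  refine ⟨K ^ (-p) * exp (-1) * c, by positivity, fun r hr => ?_⟩
  set x : ℝ := (1 + r) ^ 2
  have hx : 1 ≤ x := one_le_pow₀ (by linarith)
  have hx0 : 0 < x := by positivity
  have hpow : x ^ (-p) * x ^ (-s) = (1 + r) ^ (-(2 * (p + s))) := by
    rw [← rpow_add hx0, ← rpow_natCast_mul (by positivity)]
    congr 1
    push_cast
    ring
  have hpt : ∀ τ ∈ Ico x (K * x),
      (K * x) ^ (-p) * exp (-1) ≤ τ ^ (-p) * exp (-(r ^ 2 / (4 * τ))) := fun τ hτ => by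
    have hτ0 : 0 < τ := hx0.trans_le hτ.1
    gcongr ?_ * exp (-?_)
    · exact rpow_le_rpow_of_nonpos hτ0 hτ.2.le (neg_nonpos.2 hp)
    · rw [div_le_one (by positivity)]
      nlinarith [hτ.1]
  calc K ^ (-p) * exp (-1) * c * (1 + r) ^ (-(2 * (p + s)))
      = (K * x) ^ (-p) * exp (-1) * (c * x ^ (-s)) := by
        rw [← hpow, mul_rpow hK.le hx0.le]; ring
    _ ≤ (K * x) ^ (-p) * exp (-1) * μ.real (Ico x (K * x)) := by gcongr; exact hmass x hx
    _ ≤ ∫ τ in Ico x (K * x), τ ^ (-p) * exp (-(r ^ 2 / (4 * τ))) ∂μ := by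
        exact setIntegral_ge_of_const_le_real measurableSet_Ico (measure_ne_top _ _) hpt
          (h.integrable_rpow_neg_mul_exp hs0 hp r).integrableOn
    _ ≤ gaussMix μ p r := by
        refine setIntegral_le_integral (h.integrable_rpow_neg_mul_exp hs0 hp r) ?_
        filter_upwards [h.pos] with τ hτ
        simp only [Pi.zero_apply]
        positivity

lemma gaussMix_pos (h : IsStableLaw s μ) (hs : 0 < s) {p : ℝ} (hp : 0 ≤ p) (r : ℝ) :
    0 < gaussMix μ p r := by
  have := h.isProbabilityMeasure
  have hpos : ∀ᵐ τ ∂μ, 0 < τ ^ (-p) * exp (-(r ^ 2 / (4 * τ))) :=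
    h.pos.mono fun τ hτ => by positivity
  have hnonneg := hpos.mono fun _ => le_of_lt
  refine lt_of_le_of_ne (integral_nonneg_of_ae hnonneg) fun hzero => ?_
  obtain ⟨τ, hτ, hτ'⟩ := (hpos.and ((integral_eq_zero_iff_of_nonneg_ae hnonneg
    (h.integrable_rpow_neg_mul_exp hs hp r)).1 hzero.symm)).exists
  exact hτ.ne' hτ'

lemma hasDerivAt_gaussMix (h : IsStableLaw s μ) (hs : 0 < s) {p : ℝ} (hp : 0 ≤ p) (r : ℝ) :
    HasDerivAt (gaussMix μ p) (-(r / 2 * gaussMix μ (p + 1) r)) r := by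
  have hderiv : ∀ τ : ℝ, 0 < τ → ∀ x : ℝ,
      HasDerivAt (fun x => τ ^ (-p) * exp (-(x ^ 2 / (4 * τ))))
        (-(x / 2 * (τ ^ (-(p + 1)) * exp (-(x ^ 2 / (4 * τ)))))) x := fun τ hτ x => by
    have hquad : HasDerivAt (fun x : ℝ => -(x ^ 2 / (4 * τ))) (-(2 * x / (4 * τ))) x := by
      simpa using! ((hasDerivAt_pow 2 x).div_const (4 * τ)).neg
    refine (hquad.exp.const_mul (τ ^ (-p))).congr_deriv ?_
    rw [neg_add, ← sub_eq_add_neg, rpow_sub_one hτ.ne']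
    field_simp
    ring
  have hbound : ∀ᵐ τ ∂μ, ∀ x ∈ Metric.ball r 1,
      ‖-(x / 2 * (τ ^ (-(p + 1)) * exp (-(x ^ 2 / (4 * τ)))))‖
        ≤ (|r| + 1) / 2 * τ ^ (-(p + 1)) := by
    filter_upwards [h.pos] with τ hτ x hx
    have hxr : |x| ≤ |r| + 1 := by
      have := abs_sub_abs_le_abs_sub x r
      rw [Metric.mem_ball, dist_eq] at hx
      linarith
    rw [norm_neg, norm_mul, norm_div, norm_eq_abs, norm_two, norm_of_nonneg (by positivity)]
    gcongr
    exact mul_le_of_le_one_right (by positivity)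
      (exp_le_one_iff.2 (neg_nonpos.2 (by positivity)))
  have hparam := (hasDerivAt_integral_of_dominated_loc_of_deriv_le (Metric.ball_mem_nhds r one_pos)
    (Eventually.of_forall fun x => (h.integrable_rpow_neg_mul_exp hs hp x).aestronglyMeasurable)
    (h.integrable_rpow_neg_mul_exp hs hp r) (by fun_prop) hbound
    ((h.integrable_rpow_neg hs (by linarith)).const_mul _)
    (h.pos.mono fun τ hτ x _ => hderiv τ hτ x)).2
  rwa [integral_neg, integral_const_mul] at hparam

lemma half_mul_gaussMix_add_one_le (h : IsStableLaw s μ) (hs : 0 < s) {p r : ℝ} (hp : 0 ≤ p)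
    (hr : 0 ≤ r) : r / 2 * gaussMix μ (p + 1) r
      ≤ gaussMix μ p r / 2 + r / 2 * exp (-(r / 4)) * ∫ τ, τ ^ (-(p + 1)) ∂μ := by
  have hint := h.integrable_rpow_neg_mul_exp hs hp r
  have hint' := h.integrable_rpow_neg hs (p := p + 1) (by linarith)
  rw [gaussMix, gaussMix, ← integral_const_mul, ← integral_div, ← integral_const_mul,
    ← integral_add (hint.div_const _) (hint'.const_mul _)]
  refine integral_mono_ae ((h.integrable_rpow_neg_mul_exp hs (by linarith) r).const_mul _)
    ((hint.div_const _).add (hint'.const_mul _)) ?_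
  filter_upwards [h.pos] with τ hτ
  rcases le_total r τ with hrτ | hrτ
  · calc r / 2 * (τ ^ (-(p + 1)) * exp (-(r ^ 2 / (4 * τ))))
        ≤ τ / 2 * (τ ^ (-(p + 1)) * exp (-(r ^ 2 / (4 * τ)))) := by gcongr
      _ = τ ^ (-p) * exp (-(r ^ 2 / (4 * τ))) / 2 := by
          rw [neg_add, ← sub_eq_add_neg, rpow_sub_one hτ.ne']
          field_simp
      _ ≤ _ := le_add_of_nonneg_right (by positivity)
  · calc r / 2 * (τ ^ (-(p + 1)) * exp (-(r ^ 2 / (4 * τ))))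
        ≤ r / 2 * (τ ^ (-(p + 1)) * exp (-(r / 4))) := by
          gcongr ?_ * (?_ * exp (-?_))
          rw [div_le_div_iff₀ (by positivity) (by positivity)]
          nlinarith
      _ = r / 2 * exp (-(r / 4)) * τ ^ (-(p + 1)) := by ring
      _ ≤ _ := le_add_of_nonneg_left (by positivity)

lemma exists_half_mul_gaussMix_add_one_le (h : IsStableLaw s μ) (hs0 : 0 < s) (hs1 : s < 1) {p : ℝ}
    (hp : 0 ≤ p) :
    ∃ C : ℝ, 0 < C ∧ ∀ r : ℝ, 0 ≤ r → r / 2 * gaussMix μ (p + 1) r ≤ C * gaussMix μ p r := by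
  obtain ⟨c, hc, hlower⟩ := h.exists_le_gaussMix hs0 hs1 hp
  set q : ℝ := 2 * (p + s) + 1
  set m : ℝ := ∫ τ, τ ^ (-(p + 1)) ∂μ
  have hm : 0 ≤ m := integral_nonneg_of_ae (h.pos.mono fun τ hτ => rpow_nonneg hτ.le _)
  set A : ℝ := (q / 4⁻¹) ^ q * exp 4⁻¹
  -- the exponentially small contribution of times `τ < r` is absorbed by the power lower bound
  have habsorb : ∀ r : ℝ, 0 ≤ r → r * exp (-(r / 4)) ≤ A / c * gaussMix μ p r := fun r hr => by
    have hpow := rpow_le_mul_exp (z := 1 + r) (q := q) (a := 4⁻¹) (by positivity)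
      (by positivity) (by norm_num)
    calc r * exp (-(r / 4)) ≤ (1 + r) * exp (-(r / 4)) := by gcongr; linarith
      _ = (1 + r) ^ q * exp (-(r / 4)) * (1 + r) ^ (-(2 * (p + s))) := by
          rw [rpow_add_one (by positivity), rpow_neg (by positivity)]
          field_simp
      _ ≤ (q / 4⁻¹) ^ q * exp (4⁻¹ * (1 + r)) * exp (-(r / 4)) * (1 + r) ^ (-(2 * (p + s))) := by
          gcongr
      _ = A / c * (c * (1 + r) ^ (-(2 * (p + s)))) := by
          rw [mul_add, exp_add, mul_one, exp_neg, inv_mul_eq_div]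
          simp only [A]
          field_simp
      _ ≤ A / c * gaussMix μ p r := by gcongr; exact hlower r hr
  refine ⟨1 / 2 + A / c * m / 2, by positivity, fun r hr => ?_⟩
  calc r / 2 * gaussMix μ (p + 1) r
      ≤ gaussMix μ p r / 2 + r * exp (-(r / 4)) * m / 2 := by
        linarith [h.half_mul_gaussMix_add_one_le hs0 hp hr]
    _ ≤ gaussMix μ p r / 2 + A / c * gaussMix μ p r * m / 2 := by
        gcongr _ + ?_ * m / 2
        exact habsorb r hr
    _ = (1 / 2 + A / c * m / 2) * gaussMix μ p r := by ring

theorem exists_abs_log_gaussMix_sub_le (h : IsStableLaw s μ) (hs0 : 0 < s) (hs1 : s < 1) {p : ℝ}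
    (hp : 0 ≤ p) : ∃ C : ℝ, 0 < C ∧ ∀ a b : ℝ, 0 ≤ a → 0 ≤ b →
      |log (gaussMix μ p a) - log (gaussMix μ p b)| ≤ C * |a - b| := by
  obtain ⟨C, hC, hderiv⟩ := h.exists_half_mul_gaussMix_add_one_le hs0 hs1 hp
  refine ⟨C, hC, fun a b ha hb => (convex_Ici 0).norm_image_sub_le_of_norm_hasDerivWithin_le
    (fun r _ =>
      ((h.hasDerivAt_gaussMix hs0 hp r).log (h.gaussMix_pos hs0 hp r).ne').hasDerivWithinAt)
    (fun r (hr : 0 ≤ r) => ?_) hb ha⟩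
  have hpos := h.gaussMix_pos hs0 hp r
  have hpos' := h.gaussMix_pos hs0 (p := p + 1) (by linarith) r
  rw [neg_div, norm_neg, norm_of_nonneg (by positivity), div_le_iff₀ hpos]
  exact hderiv r hr

end IsStableLaw

end GaussianMixture

section FourierTransform

open scoped ComplexConjugate

variable {V E : Type*} [NormedAddCommGroup V] [InnerProductSpace ℝ V] [FiniteDimensional ℝ V]
  [MeasurableSpace V] [BorelSpace V] [NormedAddCommGroup E] [NormedSpace ℂ E]

lemma continuous_fourier {f : V → E} (hf : Integrable f) : Continuous (𝓕 f) :=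
  VectorFourier.fourierIntegral_continuous Real.continuous_fourierChar
    (by exact continuous_inner) hf

lemma continuous_fourierInv {f : V → E} (hf : Integrable f) : Continuous (𝓕⁻ f) := by
  rw [Real.fourierInv_eq_fourier_comp_neg]
  exact continuous_fourier hf.comp_neg

lemma norm_fourier_le (f : V → E) (ξ : V) : ‖𝓕 f ξ‖ ≤ ∫ x, ‖f x‖ :=
  VectorFourier.norm_fourierIntegral_le_integral_norm _ _ _ _ _

lemma norm_fourierInv_le (f : V → E) (x : V) : ‖𝓕⁻ f x‖ ≤ ∫ ξ, ‖f ξ‖ := by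
  rw [Real.fourierInv_eq_fourier_neg]
  exact norm_fourier_le f (-x)

lemma fourier_add_const_mul {f g : V → ℂ} (hf : Integrable f) (hg : Integrable g) (c : ℂ) (ξ : V) :
    𝓕 (fun x => f x + c * g x) ξ = 𝓕 f ξ + c * 𝓕 g ξ := by
  have hf' := (Real.fourierIntegral_convergent_iff ξ).2 hf
  have hg' := ((Real.fourierIntegral_convergent_iff ξ).2 hg).const_mul c
  rw [Real.fourier_eq, Real.fourier_eq, Real.fourier_eq, ← integral_const_mul,
    ← integral_add hf' hg']
  simp_rw [smul_add, mul_smul_comm]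

lemma fourierInv_add_const_mul {f g : V → ℂ} (hf : Integrable f) (hg : Integrable g) (c : ℂ)
    (x : V) : 𝓕⁻ (fun ξ => f ξ + c * g ξ) x = 𝓕⁻ f x + c * 𝓕⁻ g x := by
  simp only [Real.fourierInv_eq_fourier_neg, fourier_add_const_mul hf hg c (-x)]

lemma fourierInv_integral {α : Type*} [MeasurableSpace α] {μ : Measure α} [SFinite μ]
    {f : V → α → E} (hf : Integrable (Function.uncurry f) (volume.prod μ)) (x : V) :
    𝓕⁻ (fun ξ => ∫ a, f ξ a ∂μ) x = ∫ a, 𝓕⁻ (fun ξ => f ξ a) x ∂μ := by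
  simp_rw [Real.fourierInv_eq, Circle.smul_def, ← integral_smul]
  have hchar : Continuous fun ξ : V => (𝐞 (inner ℝ ξ x) : ℂ) := by fun_prop
  refine integral_integral_swap (hf.mono ?_ (ae_of_all _ fun z => ?_))
  · exact hchar.aestronglyMeasurable.comp_fst.smul hf.aestronglyMeasurable
  · simp only [Function.uncurry, norm_smul, Circle.norm_coe, one_mul, le_refl]

lemma conj_fourier (f : V → ℂ) (ξ : V) :
    conj (𝓕 f ξ) = 𝓕 (fun x => conj (f x)) (-ξ) := by
  simp_rw [Real.fourier_eq, ← integral_conj, Circle.smul_def, smul_eq_mul, map_mul,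
    inner_neg_right, AddChar.map_neg_eq_inv, Circle.coe_inv_eq_conj]

lemma conj_fourierInv (f : V → ℂ) (x : V) :
    conj (𝓕⁻ f x) = 𝓕⁻ (fun ξ => conj (f (-ξ))) x := by
  rw [Real.fourierInv_eq_fourier_neg, conj_fourier, Real.fourierInv_eq_fourier_comp_neg]
  simp only [neg_neg]

lemma ofReal_re_fourierInv {f : V → ℂ} (hf : ∀ ξ, f (-ξ) = conj (f ξ)) (x : V) :
    ((𝓕⁻ f x).re : ℂ) = 𝓕⁻ f x := by
  rw [← Complex.conj_eq_iff_re, conj_fourierInv]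
  simp only [hf, Complex.conj_conj]

lemma integral_fourier_mul_eq {f g : V → ℂ} (hf : Integrable f) (hg : Integrable g) :
    ∫ ξ, 𝓕 f ξ * g ξ = ∫ x, f x * 𝓕 g x := by
  simpa using! VectorFourier.integral_fourierIntegral_smul_eq_flip (L := innerₗ V)
    Real.continuous_fourierChar continuous_inner hf hg

lemma integral_fourierInv_mul_eq {f g : V → ℂ} (hf : Integrable f) (hg : Integrable g) :
    ∫ ξ, 𝓕⁻ f ξ * g ξ = ∫ x, f x * 𝓕⁻ g x := by
  rw [Real.fourierInv_eq_fourier_comp_neg g, ← integral_fourier_mul_eq hf hg.comp_neg,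
    ← integral_neg_eq_self]
  simp only [Real.fourierInv_eq_fourier_neg, neg_neg]

theorem ae_eq_fourierInv_fourier {f : V → ℂ} (hf : Integrable f) (hf' : Integrable (𝓕 f)) :
    f =ᵐ[volume] 𝓕⁻ (𝓕 f) := by
  refine ae_eq_of_integral_contDiff_smul_eq hf.locallyIntegrable
    (continuous_fourierInv hf').locallyIntegrable fun g hg hgc => ?_
  let G : SchwartzMap V ℂ :=
    (hgc.comp_left (g := Complex.ofReal) Complex.ofReal_zero).toSchwartzMap
      (Complex.ofRealCLM.contDiff.comp hg)
  have hinv : 𝓕 (𝓕⁻ (G : V → ℂ)) = G := by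
    rw [← SchwartzMap.fourierInv_coe, ← SchwartzMap.fourier_coe,
      FourierTransform.fourier_fourierInv_eq]
  have hint : Integrable (𝓕⁻ (G : V → ℂ)) := by
    rw [← SchwartzMap.fourierInv_coe]
    exact (𝓕⁻ G).integrable
  have hsmul : ∀ (x : V) (z : ℂ), g x • z = z * G x := fun x z => by
    rw [Complex.real_smul, mul_comm]
    rfl
  simp_rw [hsmul]
  calc ∫ x, f x * G x = ∫ x, f x * 𝓕 (𝓕⁻ (G : V → ℂ)) x := by rw [hinv]
    _ = ∫ ξ, 𝓕 f ξ * 𝓕⁻ (G : V → ℂ) ξ := (integral_fourier_mul_eq hf hint).symm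
    _ = ∫ x, 𝓕⁻ (𝓕 f) x * G x := (integral_fourierInv_mul_eq hf' G.integrable).symm

end FourierTransform

section HeatKernel

open Real

section HeatSymbol

variable {V : Type*} [NormedAddCommGroup V]

/-- The symbol `|2πξ|^{2s}` of `(-Δ)^s`, in the normalisation of Mathlib's Fourier transform. -/
noncomputable def fracSymbol (s : ℝ) (ξ : V) : ℝ :=
  (2 * π * ‖ξ‖) ^ (2 * s)

/-- The symbol `exp (-t |2πξ|^{2s})` of the heat semigroup generated by `-(-Δ)^s`; its inverse
Fourier transform is `heatKernel s t`. -/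
noncomputable def heatSymbol (s t : ℝ) (ξ : V) : ℝ :=
  exp (-(t * fracSymbol s ξ))

lemma fracSymbol_nonneg (s : ℝ) (ξ : V) : 0 ≤ fracSymbol s ξ :=
  rpow_nonneg (by positivity) _

lemma fracSymbol_neg (s : ℝ) (ξ : V) : fracSymbol s (-ξ) = fracSymbol s ξ := by
  rw [fracSymbol, norm_neg, fracSymbol]

lemma fracSymbol_one (ξ : V) : fracSymbol 1 ξ = (2 * π * ‖ξ‖) ^ 2 := by
  rw [fracSymbol, mul_one, rpow_two]

lemma continuous_fracSymbol {s : ℝ} (hs : 0 ≤ s) : Continuous (fracSymbol s : V → ℝ) :=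
  (by fun_prop : Continuous fun ξ : V => 2 * π * ‖ξ‖).rpow_const fun _ => Or.inr (by positivity)

lemma heatSymbol_pos (s t : ℝ) (ξ : V) : 0 < heatSymbol s t ξ :=
  exp_pos _

lemma heatSymbol_le_one {t : ℝ} (ht : 0 ≤ t) (s : ℝ) (ξ : V) : heatSymbol s t ξ ≤ 1 :=
  exp_le_one_iff.2 (neg_nonpos.2 (mul_nonneg ht (fracSymbol_nonneg s ξ)))

variable [InnerProductSpace ℝ V] [FiniteDimensional ℝ V] [MeasurableSpace V] [BorelSpace V]

lemma integrable_heatSymbol {s t : ℝ} (hs : 0 < s) (ht : 0 < t) :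
    Integrable (heatSymbol s t : V → ℝ) := by
  rcases subsingleton_or_nontrivial V with hV | hV
  · refine Continuous.integrable_of_hasCompactSupport ?_ (HasCompactSupport.of_compactSpace _)
    exact continuous_of_const fun x y => by rw [Subsingleton.elim x y]
  refine (integrable_fun_norm_addHaar volume
    (f := fun r => exp (-(t * (2 * π * r) ^ (2 * s))))).2 ?_
  set d : ℕ := Module.finrank ℝ V - 1
  refine (integrableOn_rpow_mul_exp_neg_mul_rpow (p := 2 * s) (s := d)
    (b := t * (2 * π) ^ (2 * s)) (by linarith [d.cast_nonneg (α := ℝ)]) (by positivity)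
    (by positivity)).congr ?_
  refine (ae_restrict_mem measurableSet_Ioi).mono fun r (hr : 0 < r) => ?_
  simp only [rpow_natCast, smul_eq_mul]
  rw [mul_rpow (by positivity) hr.le, neg_mul, mul_assoc]

lemma fourierInv_heatSymbol_one {t : ℝ} (ht : 0 < t) (x : V) :
    𝓕⁻ (fun ξ : V => (heatSymbol 1 t ξ : ℂ)) x =
      ((4 * π * t) ^ (-((Module.finrank ℝ V : ℝ) / 2)) * exp (-(‖x‖ ^ 2 / (4 * t))) : ℝ) := by
  set b : ℂ := ((4 * π ^ 2 * t : ℝ) : ℂ)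
  have hb : 0 < b.re := by rw [Complex.ofReal_re]; positivity
  have hsymbol : (fun ξ : V => (heatSymbol 1 t ξ : ℂ)) =
      fun ξ => Complex.exp (-b * (‖ξ‖ : ℂ) ^ 2) := by
    ext ξ
    rw [heatSymbol, fracSymbol_one]
    push_cast [b]
    ring_nf
  have hscale : (π : ℂ) / b = ((4 * π * t)⁻¹ : ℝ) := by
    rw [← Complex.ofReal_div]
    congr 1
    field_simp
  have hdim : (Module.finrank ℝ V : ℂ) / 2 = ((Module.finrank ℝ V : ℝ) / 2 : ℝ) := by push_cast; rfl
  have hexp : -(π : ℂ) ^ 2 * ‖-x‖ ^ 2 / b = (-(‖x‖ ^ 2 / (4 * t)) : ℝ) := by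
    rw [norm_neg, ← Complex.ofReal_pow, ← Complex.ofReal_neg, ← Complex.ofReal_pow,
      ← Complex.ofReal_mul, ← Complex.ofReal_div]
    congr 1
    field_simp
  rw [fourierInv_eq_fourier_neg, hsymbol, fourier_gaussian_innerProductSpace hb, hscale, hdim, hexp,
    ← Complex.ofReal_cpow (by positivity), inv_rpow (by positivity), ← rpow_neg (by positivity)]
  push_cast
  rfl

end HeatSymbol

variable {n : ℕ}

lemma ofReal_heatKernel (s t : ℝ) (x : EuclideanSpace ℝ (Fin n)) :
    (heatKernel s t x : ℂ) = 𝓕⁻ (fun ξ : EuclideanSpace ℝ (Fin n) => (heatSymbol s t ξ : ℂ)) x :=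
  ofReal_re_fourierInv (fun ξ => by simp only [norm_neg, Complex.conj_ofReal]) x

lemma heatKernel_one {t : ℝ} (ht : 0 < t) (x : EuclideanSpace ℝ (Fin n)) :
    heatKernel 1 t x = (4 * π * t) ^ (-((n : ℝ) / 2)) * exp (-(‖x‖ ^ 2 / (4 * t))) := by
  rw [← Complex.ofReal_inj, ofReal_heatKernel, fourierInv_heatSymbol_one ht,
    finrank_euclideanSpace_fin]

lemma continuous_heatKernel {s t : ℝ} (hs : 0 < s) (ht : 0 < t) :
    Continuous (heatKernel s t : EuclideanSpace ℝ (Fin n) → ℝ) :=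
  Complex.continuous_re.comp (continuous_fourierInv (integrable_heatSymbol hs ht).ofReal)

lemma abs_heatKernel_le (s t : ℝ) (x : EuclideanSpace ℝ (Fin n)) :
    |heatKernel s t x| ≤ ∫ ξ : EuclideanSpace ℝ (Fin n), heatSymbol s t ξ := by
  rw [← norm_eq_abs, ← Complex.norm_real, ofReal_heatKernel]
  refine (norm_fourierInv_le _ x).trans_eq (integral_congr_ae (ae_of_all _ fun ξ => ?_))
  simp only [Complex.norm_real, norm_of_nonneg (heatSymbol_pos s t ξ).le]

lemma integrable_heatKernel_mul {s t : ℝ} (hs : 0 < s) (ht : 0 < t)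
    {u₀ : EuclideanSpace ℝ (Fin n) → ℝ} (hu : Integrable u₀) (x : EuclideanSpace ℝ (Fin n)) :
    Integrable fun y => heatKernel s t (x - y) * u₀ y :=
  hu.bdd_mul ((continuous_heatKernel hs ht).comp (by fun_prop)).aestronglyMeasurable
    (ae_of_all _ fun y => abs_heatKernel_le s t (x - y))

namespace IsStableLaw

variable {s : ℝ} {μ : Measure ℝ}

lemma integral_heatSymbol_one (h : IsStableLaw s μ) (hs : 0 < s) {t : ℝ} (ht : 0 ≤ t)
    (ξ : EuclideanSpace ℝ (Fin n)) :
    ∫ τ, heatSymbol 1 (t ^ (1 / s) * τ) ξ ∂μ = heatSymbol s t ξ := by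
  have hpow : (t ^ (1 / s) * (2 * π * ‖ξ‖) ^ 2) ^ s = t * fracSymbol s ξ := by
    rw [mul_rpow (by positivity) (by positivity), ← rpow_mul ht, one_div_mul_cancel hs.ne',
      rpow_one, ← rpow_natCast_mul (by positivity), fracSymbol, Nat.cast_ofNat]
  calc ∫ τ, heatSymbol 1 (t ^ (1 / s) * τ) ξ ∂μ
      = ∫ τ, exp (-(t ^ (1 / s) * (2 * π * ‖ξ‖) ^ 2 * τ)) ∂μ := by
        simp_rw [heatSymbol, fracSymbol_one, mul_right_comm]
    _ = heatSymbol s t ξ := by rw [h.laplace _ (by positivity), hpow, heatSymbol]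

lemma integrable_heatSymbol_one (h : IsStableLaw s μ) (hs : 0 < s) {t : ℝ} (ht : 0 < t) :
    Integrable (fun z : EuclideanSpace ℝ (Fin n) × ℝ => heatSymbol 1 (t ^ (1 / s) * z.2) z.1)
      (volume.prod μ) := by
  have := h.isProbabilityMeasure
  have hmeas : Measurable
      fun z : EuclideanSpace ℝ (Fin n) × ℝ => heatSymbol 1 (t ^ (1 / s) * z.2) z.1 := by
    simp only [heatSymbol, fracSymbol_one]
    fun_prop
  rw [integrable_prod_iff hmeas.aestronglyMeasurable]
  refine ⟨ae_of_all _ fun ξ => ?_, (integrable_heatSymbol hs ht).congr (ae_of_all _ fun ξ => ?_)⟩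
  · refine Integrable.of_bound (C := 1) (hmeas.comp measurable_prodMk_left).aestronglyMeasurable ?_
    filter_upwards [h.pos] with τ hτ
    rw [norm_of_nonneg (heatSymbol_pos _ _ _).le]
    exact heatSymbol_le_one (by positivity) 1 ξ
  · simp only [norm_of_nonneg (heatSymbol_pos _ _ _).le, h.integral_heatSymbol_one hs ht.le]

lemma heatKernel_eq_integral (h : IsStableLaw s μ) (hs : 0 < s) {t : ℝ} (ht : 0 < t)
    (x : EuclideanSpace ℝ (Fin n)) :
    heatKernel s t x = ∫ τ, heatKernel 1 (t ^ (1 / s) * τ) x ∂μ := by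
  have := h.isProbabilityMeasure
  rw [← Complex.ofReal_inj, ofReal_heatKernel, ← integral_complex_ofReal]
  simp_rw [ofReal_heatKernel, ← h.integral_heatSymbol_one hs ht.le, ← integral_complex_ofReal]
  exact fourierInv_integral (h.integrable_heatSymbol_one hs ht).ofReal x

lemma heatKernel_eq_gaussMix (h : IsStableLaw s μ) (hs : 0 < s) {t : ℝ} (ht : 0 < t)
    (x : EuclideanSpace ℝ (Fin n)) :
    heatKernel s t x = (4 * π * t ^ (1 / s)) ^ (-((n : ℝ) / 2))
      * gaussMix μ (n / 2) (‖x‖ / t ^ (1 / (2 * s))) := by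
  have hsq : (t ^ (1 / (2 * s))) ^ 2 = t ^ (1 / s) := by
    rw [← rpow_mul_natCast ht.le]
    congr 1
    field_simp
    norm_num
  rw [h.heatKernel_eq_integral hs ht, gaussMix, ← integral_const_mul]
  refine integral_congr_ae ?_
  filter_upwards [h.pos] with τ hτ
  rw [heatKernel_one (by positivity), div_pow, hsq, ← mul_assoc (4 * π), ← mul_assoc,
    mul_rpow (by positivity) hτ.le]
  field_simp

end IsStableLaw

theorem heatKernel_pos {s : ℝ} (hs0 : 0 < s) (hs1 : s < 1) {t : ℝ} (ht : 0 < t)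
    (x : EuclideanSpace ℝ (Fin n)) : 0 < heatKernel s t x := by
  obtain ⟨μ, hμ⟩ := exists_isStableLaw hs0 hs1
  rw [hμ.heatKernel_eq_gaussMix hs0 ht]
  exact mul_pos (by positivity) (hμ.gaussMix_pos hs0 (by positivity) _)

theorem exists_abs_log_heatKernel_sub_le (n : ℕ) {s : ℝ} (hs0 : 0 < s) (hs1 : s < 1) :
    ∃ C : ℝ, 0 < C ∧ ∀ t : ℝ, 0 < t → ∀ x y : EuclideanSpace ℝ (Fin n),
      |log (heatKernel s t x) - log (heatKernel s t y)|
        ≤ C * ‖x - y‖ * t ^ (-(1 / (2 * s))) := by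
  obtain ⟨μ, hμ⟩ := exists_isStableLaw hs0 hs1
  obtain ⟨C, hC, hlip⟩ := hμ.exists_abs_log_gaussMix_sub_le hs0 hs1 (p := n / 2) (by positivity)
  refine ⟨C, hC, fun t ht x y => ?_⟩
  have hlog : ∀ z : EuclideanSpace ℝ (Fin n), log (heatKernel s t z) =
      log ((4 * π * t ^ (1 / s)) ^ (-((n : ℝ) / 2)))
        + log (gaussMix μ (n / 2) (‖z‖ / t ^ (1 / (2 * s)))) := fun z => by
    rw [hμ.heatKernel_eq_gaussMix hs0 ht, log_mul (by positivity)
      (hμ.gaussMix_pos hs0 (by positivity) _).ne']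
  calc |log (heatKernel s t x) - log (heatKernel s t y)|
      ≤ C * |‖x‖ / t ^ (1 / (2 * s)) - ‖y‖ / t ^ (1 / (2 * s))| := by
        rw [hlog, hlog, add_sub_add_left_eq_sub]
        exact hlip _ _ (by positivity) (by positivity)
    _ = C * |‖x‖ - ‖y‖| * t ^ (-(1 / (2 * s))) := by
        rw [← sub_div, abs_div, abs_of_pos (a := t ^ (1 / (2 * s))) (by positivity),
          rpow_neg ht.le, div_eq_mul_inv, mul_assoc]
    _ ≤ C * ‖x - y‖ * t ^ (-(1 / (2 * s))) := by
        gcongr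
        exact abs_norm_sub_norm_le x y

end HeatKernel

section RelativeError

open Real

variable {n : ℕ}

lemma abs_sub_le_two_mul_of_abs_log_sub_le {a b δ : ℝ} (ha : 0 < a) (hb : 0 < b)
    (hlog : |log a - log b| ≤ δ) (hδ : δ ≤ 1) : |a - b| ≤ 2 * δ * b := by
  have hratio : exp (log a - log b) = a / b := by rw [exp_sub, exp_log ha, exp_log hb]
  calc |a - b| = |exp (log a - log b) - 1| * b := by
        rw [hratio, div_sub_one hb.ne', abs_div, abs_of_pos hb, div_mul_cancel₀ _ hb.ne']
    _ ≤ 2 * |log a - log b| * b := by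
        gcongr
        exact abs_exp_sub_one_le (hlog.trans hδ)
    _ ≤ 2 * δ * b := by gcongr

lemma relError_heatSolution_le {s t : ℝ} (hs : 0 < s) (ht : 0 < t)
    {u₀ : EuclideanSpace ℝ (Fin n) → ℝ} (hu : Integrable u₀) {x : EuclideanSpace ℝ (Fin n)} {ε : ℝ}
    (hx : 0 < heatKernel s t x)
    (hε : ∀ᵐ y, u₀ y ≠ 0 → |heatKernel s t (x - y) - heatKernel s t x| ≤ ε * heatKernel s t x) :
    relError s (∫ y, u₀ y) t (heatSolution s u₀ t) x ≤ ε * ∫ y, |u₀ y| := by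
  rw [relError, div_le_iff₀ hx, heatSolution, ← integral_mul_const,
    ← integral_sub (integrable_heatKernel_mul hs ht hu x) (hu.mul_const _), mul_right_comm,
    ← integral_const_mul, ← norm_eq_abs]
  refine norm_integral_le_of_norm_le (hu.abs.const_mul _) ?_
  filter_upwards [hε] with y hy
  rw [mul_comm (u₀ y), ← sub_mul, norm_mul, norm_eq_abs, norm_eq_abs]
  rcases eq_or_ne (u₀ y) 0 with h0 | h0
  · rw [h0, abs_zero, mul_zero, mul_zero]
  · gcongr
    exact hy h0

theorem exists_relError_heatSolution_le (n : ℕ) {s : ℝ} (hs0 : 0 < s) (hs1 : s < 1) :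
    ∃ C : ℝ, 0 < C ∧ ∀ R t : ℝ, 0 < t → C * R * t ^ (-(1 / (2 * s))) ≤ 2 →
      ∀ u₀ : EuclideanSpace ℝ (Fin n) → ℝ, Integrable u₀ →
        (∀ᵐ y, y ∉ Metric.closedBall (0 : EuclideanSpace ℝ (Fin n)) R → u₀ y = 0) →
          ∀ x, relError s (∫ y, u₀ y) t (heatSolution s u₀ t) x
            ≤ C * (∫ y, |u₀ y|) * R * t ^ (-(1 / (2 * s))) := by
  obtain ⟨C, hC, hlip⟩ := exists_abs_log_heatKernel_sub_le n hs0 hs1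
  refine ⟨2 * C, by positivity, fun R t ht hsmall u₀ hu hsupp x => ?_⟩
  have hpos := heatKernel_pos (n := n) hs0 hs1 ht
  refine (relError_heatSolution_le hs0 ht hu (ε := 2 * (C * R * t ^ (-(1 / (2 * s))))) (hpos x)
    ?_).trans_eq (by ring)
  filter_upwards [hsupp] with y hy hy0
  have hyR : ‖y‖ ≤ R := mem_closedBall_zero_iff.1 (not_not.1 (mt hy hy0))
  refine abs_sub_le_two_mul_of_abs_log_sub_le (hpos _) (hpos x) ?_ (by linarith)
  calc |log (heatKernel s t (x - y)) - log (heatKernel s t x)|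
      ≤ C * ‖x - y - x‖ * t ^ (-(1 / (2 * s))) := hlip t ht _ _
    _ = C * ‖y‖ * t ^ (-(1 / (2 * s))) := by rw [sub_sub_cancel_left, norm_neg]
    _ ≤ C * R * t ^ (-(1 / (2 * s))) := by gcongr

end RelativeError

section Gaussian

open Real

variable {n : ℕ} {t : ℝ}

lemma heatKernel_one_pos (ht : 0 < t) (x : EuclideanSpace ℝ (Fin n)) : 0 < heatKernel 1 t x := by
  rw [heatKernel_one ht]
  positivity

lemma heatKernel_one_sub (ht : 0 < t) (x y : EuclideanSpace ℝ (Fin n)) :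
    heatKernel 1 t (x - y)
      = exp ((2 * inner ℝ x y - ‖y‖ ^ 2) / (4 * t)) * heatKernel 1 t x := by
  rw [heatKernel_one ht, heatKernel_one ht, mul_left_comm, ← exp_add, norm_sub_sq_real]
  congr 2
  field_simp
  ring

lemma relError_one_of_eq_mul (ht : 0 < t) {M a : ℝ} {v : EuclideanSpace ℝ (Fin n) → ℝ}
    {x : EuclideanSpace ℝ (Fin n)} (hv : v x = a * heatKernel 1 t x) :
    relError 1 M t v x = |a - M| := by
  have hpos := heatKernel_one_pos ht x
  rw [relError, hv, ← sub_mul, abs_mul, abs_of_pos hpos, mul_div_cancel_right₀ _ hpos.ne']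

theorem exists_lt_relError_translate {h : EuclideanSpace ℝ (Fin n)} (hh : h ≠ 0) (ht : 0 < t)
    (K : ℝ) : ∃ x, K < relError 1 1 t (fun z => heatKernel 1 t (z - h)) x := by
  have : 0 < ‖h‖ := norm_pos_iff.2 hh
  set l : ℝ := ((K + 1) * (4 * t) / ‖h‖ ^ 2 + 1) / 2 with hl
  have hexponent : (2 * inner ℝ (l • h) h - ‖h‖ ^ 2) / (4 * t) = K + 1 := by
    rw [real_inner_smul_left, real_inner_self_eq_norm_sq, hl]
    field_simp
    ring
  refine ⟨l • h, ?_⟩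
  rw [relError_one_of_eq_mul (v := fun z => heatKernel 1 t (z - h)) ht
    (heatKernel_one_sub ht (l • h) h), hexponent]
  linarith [add_one_le_exp (K + 1), le_abs_self (exp (K + 1) - 1)]

lemma integrable_exp_inner_mul (ht : 0 < t) {u₀ : EuclideanSpace ℝ (Fin n) → ℝ}
    (hu : Integrable u₀) (x : EuclideanSpace ℝ (Fin n)) :
    Integrable fun y => exp ((2 * inner ℝ x y - ‖y‖ ^ 2) / (4 * t)) * u₀ y := by
  have hpos := heatKernel_one_pos ht x
  refine ((integrable_heatKernel_mul one_pos ht hu x).const_mul (heatKernel 1 t x)⁻¹).congr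
    (ae_of_all _ fun y => ?_)
  simp only [heatKernel_one_sub ht]
  field_simp

lemma heatSolution_one (ht : 0 < t) (u₀ : EuclideanSpace ℝ (Fin n) → ℝ)
    (x : EuclideanSpace ℝ (Fin n)) :
    heatSolution 1 u₀ t x
      = (∫ y, exp ((2 * inner ℝ x y - ‖y‖ ^ 2) / (4 * t)) * u₀ y) * heatKernel 1 t x := by
  rw [heatSolution, ← integral_mul_const]
  simp_rw [heatKernel_one_sub ht, mul_right_comm]

/-- The Gaussian weight, cut off to the half-space of directions `e`, which bounds the growth of
`y ↦ exp ((2⟪l • e, y⟫ - ‖y‖²) / 4t)` in `l` from below. -/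
noncomputable def directionalWeight (t : ℝ) (e y : EuclideanSpace ℝ (Fin n)) : ℝ :=
  max (inner ℝ e y) 0 * exp (-(‖y‖ ^ 2 / (4 * t)))

lemma directionalWeight_nonneg (t : ℝ) (e y : EuclideanSpace ℝ (Fin n)) :
    0 ≤ directionalWeight t e y :=
  mul_nonneg (le_max_right _ _) (exp_pos _).le

lemma continuous_directionalWeight (t : ℝ) (e : EuclideanSpace ℝ (Fin n)) :
    Continuous (directionalWeight t e) := by
  unfold directionalWeight
  fun_prop

lemma directionalWeight_eq_zero {e y : EuclideanSpace ℝ (Fin n)} :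
    directionalWeight t e y = 0 ↔ inner ℝ e y ≤ 0 := by
  rw [directionalWeight, mul_eq_zero, or_iff_left (exp_pos _).ne', max_eq_right_iff]

lemma mul_directionalWeight_le_exp (ht : 0 < t) {l : ℝ} (hl : 0 ≤ l)
    (e y : EuclideanSpace ℝ (Fin n)) :
    l / (2 * t) * directionalWeight t e y ≤ exp ((2 * inner ℝ (l • e) y - ‖y‖ ^ 2) / (4 * t)) := by
  have hlinear : l / (2 * t) * max (inner ℝ e y) 0 ≤ exp (l / (2 * t) * inner ℝ e y) := by
    rw [mul_max_of_nonneg _ _ (by positivity), mul_zero]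
    exact max_le (by linarith [add_one_le_exp (l / (2 * t) * inner ℝ e y)]) (exp_pos _).le
  have hexponent : l / (2 * t) * inner ℝ e y + -(‖y‖ ^ 2 / (4 * t))
      = (2 * inner ℝ (l • e) y - ‖y‖ ^ 2) / (4 * t) := by
    rw [real_inner_smul_left]
    field_simp
    ring
  calc l / (2 * t) * directionalWeight t e y
      = l / (2 * t) * max (inner ℝ e y) 0 * exp (-(‖y‖ ^ 2 / (4 * t))) := (mul_assoc _ _ _).symm
    _ ≤ exp (l / (2 * t) * inner ℝ e y) * exp (-(‖y‖ ^ 2 / (4 * t))) := by gcongr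
    _ = exp ((2 * inner ℝ (l • e) y - ‖y‖ ^ 2) / (4 * t)) := by rw [← exp_add, hexponent]

lemma eq_zero_of_directionalWeight_single {y : EuclideanSpace ℝ (Fin n)}
    (hpos : ∀ i, directionalWeight t (EuclideanSpace.single i 1) y = 0)
    (hneg : ∀ i, directionalWeight t (-EuclideanSpace.single i 1) y = 0) : y = 0 := by
  ext i
  have hle := directionalWeight_eq_zero.1 (hpos i)
  have hge := directionalWeight_eq_zero.1 (hneg i)
  rw [inner_neg_left] at hge
  simp only [EuclideanSpace.inner_single_left, map_one, one_mul] at hle hge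
  rw [PiLp.zero_apply]
  linarith

variable {u₀ : EuclideanSpace ℝ (Fin n) → ℝ}

lemma integrable_directionalWeight_mul (ht : 0 < t) (hu : Integrable u₀)
    (e : EuclideanSpace ℝ (Fin n)) : Integrable fun y => directionalWeight t e y * u₀ y := by
  refine (integrable_exp_inner_mul ht hu ((2 * t) • e)).mono
    ((continuous_directionalWeight t e).aestronglyMeasurable.mul hu.aestronglyMeasurable)
    (ae_of_all _ fun y => ?_)
  have hle := mul_directionalWeight_le_exp ht (l := 2 * t) (by positivity) e y
  rw [div_self (by positivity), one_mul] at hle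
  rw [norm_mul, norm_mul, norm_of_nonneg (directionalWeight_nonneg t e y),
    norm_of_nonneg (exp_pos _).le]
  gcongr

lemma exists_integral_directionalWeight_mul_pos (hn : 1 ≤ n) (ht : 0 < t) (hu : Integrable u₀)
    (hu0 : 0 ≤ᵐ[volume] u₀) (hM : 0 < ∫ y, u₀ y) :
    ∃ e : EuclideanSpace ℝ (Fin n), 0 < ∫ y, directionalWeight t e y * u₀ y := by
  have : Nonempty (Fin n) := ⟨⟨0, hn⟩⟩
  by_contra! hnonpos
  have hzero : ∀ e, ∀ᵐ y, directionalWeight t e y * u₀ y = 0 := fun e => by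
    have hnonneg : 0 ≤ᵐ[volume] fun y => directionalWeight t e y * u₀ y :=
      hu0.mono fun y hy => mul_nonneg (directionalWeight_nonneg t e y) hy
    exact (integral_eq_zero_iff_of_nonneg_ae hnonneg (integrable_directionalWeight_mul ht hu e)).1
      (le_antisymm (hnonpos e) (integral_nonneg_of_ae hnonneg))
  have hpos := ae_all_iff.2 fun i : Fin n => hzero (EuclideanSpace.single i 1)
  have hneg := ae_all_iff.2 fun i : Fin n => hzero (-EuclideanSpace.single i 1)
  refine hM.ne' (integral_eq_zero_of_ae ?_)
  filter_upwards [hpos, hneg, volume.ae_ne 0] with y hypos hyneg hy0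
  by_contra hu0y
  exact hy0 (eq_zero_of_directionalWeight_single
    (fun i => (mul_eq_zero.1 (hypos i)).resolve_right hu0y)
    (fun i => (mul_eq_zero.1 (hyneg i)).resolve_right hu0y))

theorem exists_lt_relError_heatSolution_one (hn : 1 ≤ n) (hu : Integrable u₀)
    (hu0 : 0 ≤ᵐ[volume] u₀) (hM : 0 < ∫ y, u₀ y) (ht : 0 < t) (K : ℝ) :
    ∃ x, K < relError 1 (∫ y, u₀ y) t (heatSolution 1 u₀ t) x := by
  obtain ⟨e, he⟩ := exists_integral_directionalWeight_mul_pos hn ht hu hu0 hM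
  set M := ∫ y, u₀ y
  set J := ∫ y, directionalWeight t e y * u₀ y with hJ
  set l : ℝ := (|K| + M + 1) * (2 * t) / J with hl
  have hlower : |K| + M + 1
      ≤ ∫ y, exp ((2 * inner ℝ (l • e) y - ‖y‖ ^ 2) / (4 * t)) * u₀ y := by
    calc |K| + M + 1 = l / (2 * t) * J := by rw [hl]; field_simp
      _ = ∫ y, l / (2 * t) * (directionalWeight t e y * u₀ y) := by rw [hJ, integral_const_mul]
      _ ≤ ∫ y, exp ((2 * inner ℝ (l • e) y - ‖y‖ ^ 2) / (4 * t)) * u₀ y := by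
        refine integral_mono_ae ((integrable_directionalWeight_mul ht hu e).const_mul _)
          (integrable_exp_inner_mul ht hu _) ?_
        filter_upwards [hu0] with y hy
        rw [← mul_assoc]
        exact mul_le_mul_of_nonneg_right
          (mul_directionalWeight_le_exp ht (by positivity) e y) hy
  refine ⟨l • e, lt_of_lt_of_le ?_ (le_abs_self _ |>.trans_eq
    (relError_one_of_eq_mul ht (heatSolution_one ht u₀ (l • e))).symm)⟩
  linarith [le_abs_self K]

end Gaussian

section ComplexFracLaplacian

open Real SchwartzMap

variable {V : Type*} [NormedAddCommGroup V] [InnerProductSpace ℝ V] [FiniteDimensional ℝ V]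
  [MeasurableSpace V] [BorelSpace V] {s : ℝ}

/-- `(-Δ)^s` on complex-valued functions, through its Fourier symbol; on real-valued ones it agrees
with `fracLaplacian`. -/
noncomputable def complexFracLaplacian (s : ℝ) (ψ : V → ℂ) : V → ℂ :=
  𝓕⁻ fun ξ => (fracSymbol s ξ : ℂ) * 𝓕 ψ ξ

lemma rpow_add_le (hs : 0 ≤ s) {a b : ℝ} (ha : 0 ≤ a) (hb : 0 ≤ b) :
    (a + b) ^ s ≤ 1 + 2 ^ (⌈s⌉₊ - 1) * (a ^ ⌈s⌉₊ + b ^ ⌈s⌉₊) := by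
  have hpow : (a + b) ^ s ≤ 1 + (a + b) ^ ⌈s⌉₊ := by
    rcases le_total (a + b) 1 with h | h
    · exact (rpow_le_one (by positivity) h hs).trans (le_add_of_nonneg_right (by positivity))
    · have := rpow_le_rpow_of_exponent_le h (Nat.le_ceil s)
      rw [rpow_natCast] at this
      linarith
  linarith [add_pow_le ha hb ⌈s⌉₊]

lemma integrable_rpow_mul_norm_schwartz (hs : 0 ≤ s) {a : ℝ} (ha : 0 ≤ a) (G : 𝓢(V, ℂ)) :
    Integrable fun ζ => (2 * π * (a + ‖ζ‖)) ^ (2 * s) * ‖G ζ‖ := by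
  set k := ⌈2 * s⌉₊
  have hconst := (G.integrable (μ := volume)).norm.const_mul (1 + 2 ^ (k - 1) * (2 * π * a) ^ k)
  have hmoment := (G.integrable_pow_mul volume k).const_mul (2 ^ (k - 1) * (2 * π) ^ k)
  refine (hconst.add hmoment).mono' ?_ (ae_of_all _ fun ζ => ?_)
  · refine (Continuous.mul ?_ G.continuous.norm).aestronglyMeasurable
    exact (by fun_prop : Continuous fun ζ : V => 2 * π * (a + ‖ζ‖)).rpow_const
      fun _ => Or.inr (by positivity)
  · rw [norm_of_nonneg (by positivity)]
    calc (2 * π * (a + ‖ζ‖)) ^ (2 * s) * ‖G ζ‖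
        ≤ (1 + 2 ^ (k - 1) * ((2 * π * a) ^ k + (2 * π * ‖ζ‖) ^ k)) * ‖G ζ‖ := by
          rw [mul_add]
          gcongr
          exact rpow_add_le (by positivity) (by positivity) (by positivity)
      _ = _ := by simp only [Pi.add_apply, mul_pow]; ring

lemma integrable_fracSymbol_mul_fourier (hs : 0 ≤ s) {ψ : V → ℂ} (hψ : ContDiff ℝ (⊤ : ℕ∞) ψ)
    (hψc : HasCompactSupport ψ) : Integrable fun ξ => (fracSymbol s ξ : ℂ) * 𝓕 ψ ξ := by
  set G : 𝓢(V, ℂ) := 𝓕 (hψc.toSchwartzMap hψ)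
  have hG : 𝓕 ψ = G := (SchwartzMap.fourier_coe (hψc.toSchwartzMap hψ)).symm
  rw [hG]
  refine (integrable_rpow_mul_norm_schwartz hs le_rfl G).mono'
    ((Complex.continuous_ofReal.comp (continuous_fracSymbol hs)).mul
      G.continuous).aestronglyMeasurable (ae_of_all _ fun ξ => ?_)
  rw [norm_mul, Complex.norm_real, norm_of_nonneg (fracSymbol_nonneg s ξ), fracSymbol, zero_add]

lemma continuous_complexFracLaplacian (hs : 0 ≤ s) {ψ : V → ℂ} (hψ : ContDiff ℝ (⊤ : ℕ∞) ψ)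
    (hψc : HasCompactSupport ψ) : Continuous (complexFracLaplacian s ψ) :=
  continuous_fourierInv (integrable_fracSymbol_mul_fourier hs hψ hψc)

lemma complexFracLaplacian_add_const_mul (hs : 0 ≤ s) {φ ψ : V → ℂ}
    (hφ : ContDiff ℝ (⊤ : ℕ∞) φ) (hφc : HasCompactSupport φ) (hψ : ContDiff ℝ (⊤ : ℕ∞) ψ)
    (hψc : HasCompactSupport ψ) (c : ℂ) (x : V) :
    complexFracLaplacian s (fun y => φ y + c * ψ y) x
      = complexFracLaplacian s φ x + c * complexFracLaplacian s ψ x := by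
  simp_rw [complexFracLaplacian, fourier_add_const_mul
    (hφ.continuous.integrable_of_hasCompactSupport hφc)
    (hψ.continuous.integrable_of_hasCompactSupport hψc), mul_add, mul_left_comm _ c]
  exact fourierInv_add_const_mul (integrable_fracSymbol_mul_fourier hs hφ hφc)
    (integrable_fracSymbol_mul_fourier hs hψ hψc) c x

lemma ofReal_fracLaplacian {n : ℕ} (s : ℝ) (φ : EuclideanSpace ℝ (Fin n) → ℝ)
    (x : EuclideanSpace ℝ (Fin n)) :
    (fracLaplacian s φ x : ℂ) = complexFracLaplacian s (fun y => (φ y : ℂ)) x := by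
  refine ofReal_re_fourierInv (fun ξ => ?_) x
  rw [map_mul, conj_fourier, norm_neg]
  simp only [Complex.conj_ofReal]

lemma complexFracLaplacian_eq {n : ℕ} (hs : 0 ≤ s) {ψ : EuclideanSpace ℝ (Fin n) → ℂ}
    (hψ : ContDiff ℝ (⊤ : ℕ∞) ψ) (hψc : HasCompactSupport ψ) (x : EuclideanSpace ℝ (Fin n)) :
    complexFracLaplacian s ψ x = fracLaplacian s (fun y => (ψ y).re) x
      + Complex.I * fracLaplacian s (fun y => (ψ y).im) x := by
  have hre : HasCompactSupport fun y => ((ψ y).re : ℂ) :=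
    hψc.comp_left (g := fun z : ℂ => (z.re : ℂ)) rfl
  have him : HasCompactSupport fun y => ((ψ y).im : ℂ) :=
    hψc.comp_left (g := fun z : ℂ => (z.im : ℂ)) rfl
  rw [ofReal_fracLaplacian, ofReal_fracLaplacian, ← complexFracLaplacian_add_const_mul hs
    (φ := fun y => ((ψ y).re : ℂ)) (ψ := fun y => ((ψ y).im : ℂ))
    ((Complex.ofRealCLM.comp Complex.reCLM).contDiff.comp hψ) hre
    ((Complex.ofRealCLM.comp Complex.imCLM).contDiff.comp hψ) him]
  simp_rw [mul_comm Complex.I, Complex.re_add_im]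

end ComplexFracLaplacian

section CutWave

open Real SchwartzMap

variable {V : Type*} [NormedAddCommGroup V] [InnerProductSpace ℝ V] [FiniteDimensional ℝ V]

variable (V) in
/-- A smooth cutoff function, equal to `1` on the unit ball; its rescalings truncate plane waves to
test functions. -/
noncomputable def cutoff : ContDiffBump (0 : V) :=
  ⟨1, 2, one_pos, one_lt_two⟩

/-- The plane wave of frequency `ξ`, cut off at scale `ε⁻¹`. -/
noncomputable def cutWave (ε : ℝ) (ξ x : V) : ℂ :=
  (cutoff V (ε • x) : ℂ) * (𝐞 (inner ℝ x ξ) : ℂ)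

lemma cutoff_zero : cutoff V 0 = 1 :=
  (cutoff V).one_of_mem_closedBall (Metric.mem_closedBall_self (cutoff V).rIn_pos.le)

lemma norm_cutWave_le (ε : ℝ) (ξ x : V) : ‖cutWave ε ξ x‖ ≤ 1 := by
  rw [cutWave, norm_mul, Circle.norm_coe, mul_one, Complex.norm_real,
    norm_of_nonneg (cutoff V).nonneg]
  exact (cutoff V).le_one

lemma contDiff_cutWave (ε : ℝ) (ξ : V) : ContDiff ℝ (⊤ : ℕ∞) (cutWave ε ξ) := by
  have hphase : ContDiff ℝ (⊤ : ℕ∞) fun x : V => 2 * π * (inner ℝ x ξ : ℝ) :=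
    contDiff_const.mul (contDiff_id.inner ℝ contDiff_const)
  unfold cutWave
  simp_rw [fourierChar_apply]
  exact (Complex.ofRealCLM.contDiff.comp ((cutoff V).contDiff.comp (by fun_prop))).mul
    ((Complex.ofRealCLM.contDiff.comp hphase).mul contDiff_const).cexp

lemma hasCompactSupport_cutWave {ε : ℝ} (hε : ε ≠ 0) (ξ : V) :
    HasCompactSupport (cutWave ε ξ) := by
  have hcutoff : HasCompactSupport fun x : V => cutoff V (ε • x) :=
    (cutoff V).hasCompactSupport.comp_homeomorph (Homeomorph.smulOfNeZero ε hε)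
  exact (hcutoff.comp_left (g := Complex.ofReal) Complex.ofReal_zero).mul_right

lemma tendsto_cutWave (ξ x : V) :
    Tendsto (fun ε => cutWave ε ξ x) (𝓝[>] 0) (𝓝 (𝐞 (inner ℝ x ξ) : ℂ)) := by
  have hcont : Continuous fun ε : ℝ => cutWave ε ξ x := by
    refine Continuous.mul ?_ continuous_const
    exact Complex.continuous_ofReal.comp ((cutoff V).continuous.comp (by fun_prop))
  have hzero : cutWave 0 ξ x = 𝐞 (inner ℝ x ξ) := by
    rw [cutWave, zero_smul, cutoff_zero, Complex.ofReal_one, one_mul]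
  exact hzero ▸ (hcont.tendsto 0).mono_left nhdsWithin_le_nhds

variable (V) in
/-- The cutoff function as a complex Schwartz function, for the sake of its Fourier transform. -/
noncomputable def cutoffSchwartz : 𝓢(V, ℂ) :=
  ((cutoff V).hasCompactSupport.comp_left (g := Complex.ofReal) Complex.ofReal_zero).toSchwartzMap
    (Complex.ofRealCLM.contDiff.comp (cutoff V).contDiff)

lemma cutoffSchwartz_apply (x : V) : cutoffSchwartz V x = (cutoff V x : ℂ) :=
  rfl

variable [MeasurableSpace V] [BorelSpace V] {s : ℝ}

lemma integral_fourier_cutoffSchwartz : ∫ ζ, 𝓕 (cutoffSchwartz V) ζ = 1 := by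
  have hinv : 𝓕⁻ (𝓕 (cutoffSchwartz V)) 0 = cutoffSchwartz V 0 := by
    rw [FourierTransform.fourierInv_fourier_eq]
  rw [SchwartzMap.fourierInv_coe, fourierInv_eq, cutoffSchwartz_apply, cutoff_zero] at hinv
  simpa using hinv

lemma fourier_cutWave {ε : ℝ} (hε : 0 ≤ ε) (ξ ζ : V) :
    𝓕 (cutWave ε ξ) (ξ + ε • ζ) = (ε ^ Module.finrank ℝ V)⁻¹ • 𝓕 (cutoffSchwartz V) ζ := by
  rw [SchwartzMap.fourier_coe, fourier_eq, fourier_eq, ← Measure.integral_comp_smul_of_nonneg volume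
    (fun v => 𝐞 (-inner ℝ v ζ) • cutoffSchwartz V v) ε (hR := hε)]
  congr 1 with v
  have hphase : -inner ℝ v (ξ + ε • ζ) + inner ℝ v ξ = -inner ℝ (ε • v) ζ := by
    rw [inner_add_right, real_inner_smul_left, real_inner_smul_right]
    ring
  rw [cutWave, cutoffSchwartz_apply, Circle.smul_def, Circle.smul_def, smul_eq_mul, smul_eq_mul,
    mul_left_comm, ← Circle.coe_mul, ← AddChar.map_add_eq_mul, hphase, mul_comm]

lemma complexFracLaplacian_cutWave {ε : ℝ} (hε : 0 < ε) (ξ x : V) :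
    complexFracLaplacian s (cutWave ε ξ) x = ∫ ζ, (𝐞 (inner ℝ (ξ + ε • ζ) x) : ℂ)
      * ((fracSymbol s (ξ + ε • ζ) : ℂ) * 𝓕 (cutoffSchwartz V) ζ) := by
  have hscale := Measure.integral_comp_smul_of_nonneg (volume : Measure V) (fun η =>
    𝐞 (inner ℝ (ξ + η) x) • ((fracSymbol s (ξ + η) : ℂ) * 𝓕 (cutWave ε ξ) (ξ + η))) ε (hR := hε.le)
  simp_rw [fourier_cutWave hε.le, mul_smul_comm, smul_comm (𝐞 _)] at hscale
  rw [integral_smul, integral_add_left_eq_self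
    (fun η => 𝐞 (inner ℝ η x) • ((fracSymbol s η : ℂ) * 𝓕 (cutWave ε ξ) η))] at hscale
  rw [complexFracLaplacian, fourierInv_eq]
  exact (smul_right_injective ℂ (inv_ne_zero (pow_ne_zero _ hε.ne')) hscale).symm

lemma norm_symbol_mul_fourier_cutoffSchwartz_le (hs : 0 ≤ s) {ε : ℝ} (hε0 : 0 ≤ ε) (hε1 : ε ≤ 1)
    (ξ x ζ : V) :
    ‖(𝐞 (inner ℝ (ξ + ε • ζ) x) : ℂ) * ((fracSymbol s (ξ + ε • ζ) : ℂ) * 𝓕 (cutoffSchwartz V) ζ)‖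
      ≤ (2 * π * (‖ξ‖ + ‖ζ‖)) ^ (2 * s) * ‖𝓕 (cutoffSchwartz V) ζ‖ := by
  have hnorm : ‖ξ + ε • ζ‖ ≤ ‖ξ‖ + ‖ζ‖ := by
    refine (norm_add_le _ _).trans ?_
    rw [norm_smul, norm_of_nonneg hε0]
    linarith [mul_le_of_le_one_left (norm_nonneg ζ) hε1]
  rw [norm_mul, Circle.norm_coe, one_mul, norm_mul, Complex.norm_real,
    norm_of_nonneg (fracSymbol_nonneg _ _), fracSymbol]
  gcongr

lemma exists_norm_complexFracLaplacian_cutWave_le (hs : 0 ≤ s) (ξ : V) :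
    ∃ B : ℝ, ∀ ε : ℝ, 0 < ε → ε ≤ 1 → ∀ x, ‖complexFracLaplacian s (cutWave ε ξ) x‖ ≤ B := by
  refine ⟨∫ ζ, (2 * π * (‖ξ‖ + ‖ζ‖)) ^ (2 * s) * ‖𝓕 (cutoffSchwartz V) ζ‖,
    fun ε hε0 hε1 x => ?_⟩
  rw [complexFracLaplacian_cutWave hε0]
  exact norm_integral_le_of_norm_le
    (integrable_rpow_mul_norm_schwartz hs (norm_nonneg ξ) (𝓕 (cutoffSchwartz V)))
    (ae_of_all _ (norm_symbol_mul_fourier_cutoffSchwartz_le hs hε0.le hε1 ξ x))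

lemma tendsto_complexFracLaplacian_cutWave (hs : 0 ≤ s) (ξ x : V) :
    Tendsto (fun ε => complexFracLaplacian s (cutWave ε ξ) x) (𝓝[>] 0)
      (𝓝 ((fracSymbol s ξ : ℂ) * (𝐞 (inner ℝ x ξ) : ℂ))) := by
  have hcont : Continuous fun p : ℝ × V => (𝐞 (inner ℝ (ξ + p.1 • p.2) x) : ℂ)
      * ((fracSymbol s (ξ + p.1 • p.2) : ℂ) * 𝓕 (cutoffSchwartz V) p.2) :=
    Continuous.mul (by fun_prop) <| .mul
      (Complex.continuous_ofReal.comp ((continuous_fracSymbol hs).comp (by fun_prop)))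
      ((𝓕 (cutoffSchwartz V)).continuous.comp continuous_snd)
  have hlim : (fracSymbol s ξ : ℂ) * (𝐞 (inner ℝ x ξ) : ℂ) = ∫ ζ, (𝐞 (inner ℝ ξ x) : ℂ)
      * ((fracSymbol s ξ : ℂ) * 𝓕 (cutoffSchwartz V) ζ) := by
    rw [integral_const_mul, integral_const_mul, integral_fourier_cutoffSchwartz, mul_one,
      real_inner_comm, mul_comm]
  rw [hlim]
  refine (tendsto_integral_filter_of_dominated_convergence _ (Eventually.of_forall fun ε =>
    (hcont.comp (Continuous.prodMk_right ε)).aestronglyMeasurable) ?_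
    (integrable_rpow_mul_norm_schwartz hs (norm_nonneg ξ) (𝓕 (cutoffSchwartz V)))
    (ae_of_all _ fun ζ => ?_)).congr' ?_
  · filter_upwards [Ioc_mem_nhdsGT one_pos] with ε hε
    exact ae_of_all _ (norm_symbol_mul_fourier_cutoffSchwartz_le hs hε.1.le hε.2 ξ x)
  · have hζ := (hcont.comp (Continuous.prodMk_left ζ)).tendsto 0
    simp only [Function.comp_apply, zero_smul, add_zero] at hζ
    exact hζ.mono_left nhdsWithin_le_nhds
  · filter_upwards [self_mem_nhdsWithin] with ε hε
    exact (complexFracLaplacian_cutWave hε ξ x).symm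

end CutWave

section IntegratedEquation

variable {E : Type*} [NormedAddCommGroup E] [NormedSpace ℝ E] [CompleteSpace E]

lemma hasDerivWithinAt_of_eq_sub_integral {y f : ℝ → E} {c : E} (hf : ContinuousOn f (Set.Ici 0))
    (h : ∀ t, 0 ≤ t → y t = c - ∫ τ in (0 : ℝ)..t, f τ) {t : ℝ} (ht : 0 ≤ t) :
    HasDerivWithinAt y (-f t) (Set.Ici t) t := by
  have hsub : Set.Ici t ⊆ Set.Ici 0 := Set.Ici_subset_Ici.2 ht
  have hint : IntervalIntegrable f volume 0 t :=
    (hf.mono (by rw [Set.uIcc_of_le ht]; exact Set.Icc_subset_Ici_self)).intervalIntegrable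
  have hmeas : StronglyMeasurableAtFilter f (𝓝[>] t) :=
    ⟨Set.Ioi t, self_mem_nhdsWithin, (hf.mono
      (Set.Ioi_subset_Ici_self.trans hsub)).aestronglyMeasurable measurableSet_Ioi⟩
  have hderiv := intervalIntegral.integral_hasDerivWithinAt_right (s := Set.Ici t) hint hmeas
    ((hf t ht).mono (Set.Ioi_subset_Ici_self.trans hsub))
  exact (hderiv.const_sub c).congr (fun r hr => h r (hsub hr)) (h t ht)

lemma eq_exp_smul_of_eq_sub_integral {y : ℝ → E} {a : ℝ} {c : E} (hy : ContinuousOn y (Set.Ici 0))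
    (h : ∀ t, 0 ≤ t → y t = c - ∫ τ in (0 : ℝ)..t, a • y τ) {t : ℝ} (ht : 0 ≤ t) :
    y t = Real.exp (-(t * a)) • c := by
  have hderiv : ∀ τ ∈ Set.Ico 0 t,
      HasDerivWithinAt (fun τ => Real.exp (τ * a) • y τ) 0 (Set.Ici τ) τ := fun τ hτ => by
    convert! (((hasDerivAt_id τ).mul_const a).exp.hasDerivWithinAt).smul
      (hasDerivWithinAt_of_eq_sub_integral (hy.const_smul a) h hτ.1) using 1
    simp only [id, Pi.smul_apply, one_mul, smul_neg, smul_smul, neg_add_cancel]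
  have hcont : ContinuousOn (fun τ => Real.exp (τ * a) • y τ) (Set.Icc 0 t) :=
    (by fun_prop : Continuous fun τ : ℝ => Real.exp (τ * a)).continuousOn.smul
      (hy.mono Set.Icc_subset_Ici_self)
  have hconst := constant_of_has_deriv_right_zero hcont hderiv t ⟨ht, le_rfl⟩
  have hzero : y 0 = c := by simpa using h 0 le_rfl
  rw [zero_mul, Real.exp_zero, one_smul, hzero] at hconst
  rw [← hconst, smul_smul, ← Real.exp_add, neg_add_cancel, Real.exp_zero, one_smul]

end IntegratedEquation

section HeatSolution

open Real

variable {n : ℕ} {s t : ℝ}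

lemma integrable_heatSymbol_mul_fourier (hs : 0 < s) (ht : 0 < t)
    {U : EuclideanSpace ℝ (Fin n) → ℂ} (hU : Integrable U) :
    Integrable fun ξ => (heatSymbol s t ξ : ℂ) * 𝓕 U ξ :=
  (integrable_heatSymbol hs ht).ofReal.mul_bdd (continuous_fourier hU).aestronglyMeasurable
    (ae_of_all _ (norm_fourier_le U))

lemma ofReal_heatSolution (hs : 0 < s) (ht : 0 < t) {u₀ : EuclideanSpace ℝ (Fin n) → ℝ}
    (hu : Integrable u₀) (x : EuclideanSpace ℝ (Fin n)) :
    (heatSolution s u₀ t x : ℂ)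
      = 𝓕⁻ (fun ξ => (heatSymbol s t ξ : ℂ) * 𝓕 (fun y => (u₀ y : ℂ)) ξ) x := by
  have hg : Integrable fun ξ : EuclideanSpace ℝ (Fin n) =>
      (𝐞 (inner ℝ ξ x) : ℂ) * (heatSymbol s t ξ : ℂ) :=
    (integrable_heatSymbol hs ht).ofReal.bdd_mul (Continuous.aestronglyMeasurable (by fun_prop))
      (ae_of_all _ fun ξ => (Circle.norm_coe _).le)
  have hkernel : ∀ y, 𝓕 (fun ξ => (𝐞 (inner ℝ ξ x) : ℂ) * (heatSymbol s t ξ : ℂ)) y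
      = heatKernel s t (x - y) := fun y => by
    rw [ofReal_heatKernel, fourierInv_eq, fourier_eq]
    congr 1 with ξ
    rw [Circle.smul_def, Circle.smul_def, smul_eq_mul, smul_eq_mul, ← mul_assoc, ← Circle.coe_mul,
      ← AddChar.map_add_eq_mul, inner_sub_right, neg_add_eq_sub]
  calc (heatSolution s u₀ t x : ℂ)
      = ∫ y, (u₀ y : ℂ) * 𝓕 (fun ξ => (𝐞 (inner ℝ ξ x) : ℂ) * (heatSymbol s t ξ : ℂ)) y := by
        rw [heatSolution, ← integral_complex_ofReal]
        simp_rw [hkernel, Complex.ofReal_mul, mul_comm]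
    _ = ∫ ξ, 𝓕 (fun y => (u₀ y : ℂ)) ξ * ((𝐞 (inner ℝ ξ x) : ℂ) * (heatSymbol s t ξ : ℂ)) :=
        (integral_fourier_mul_eq hu.ofReal hg).symm
    _ = _ := by
        rw [fourierInv_eq]
        congr 1 with ξ
        rw [Circle.smul_def, smul_eq_mul, mul_comm, mul_assoc]

end HeatSolution

section IntegralAgainstBounded

variable {α E : Type*} [MeasurableSpace α] {μ : Measure α} [NormedAddCommGroup E]
  [NormedSpace ℝ E] {v : α → ℝ}

lemma tendsto_integral_smul_of_bounded {ι : Type*} {l : Filter ι} [l.IsCountablyGenerated]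
    (hv : Integrable v μ) {g : ι → α → E} {g' : α → E} {B : ℝ}
    (hg : ∀ᶠ i in l, AEStronglyMeasurable (g i) μ) (hB : ∀ᶠ i in l, ∀ x, ‖g i x‖ ≤ B)
    (hlim : ∀ x, Tendsto (fun i => g i x) l (𝓝 (g' x))) :
    Tendsto (fun i => ∫ x, v x • g i x ∂μ) l (𝓝 (∫ x, v x • g' x ∂μ)) := by
  refine tendsto_integral_filter_of_dominated_convergence (fun x => ‖v x‖ * B)
    (hg.mono fun i hi => hv.aestronglyMeasurable.smul hi) (hB.mono fun i hi => ae_of_all _ fun x =>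
      ?_) (hv.norm.mul_const _) (ae_of_all _ fun x => (hlim x).const_smul _)
  rw [norm_smul]
  exact mul_le_mul_of_nonneg_left (hi x) (norm_nonneg _)

lemma norm_integral_smul_le_of_bounded (hv : Integrable v μ) {g : α → E} {B : ℝ}
    (hB : ∀ x, ‖g x‖ ≤ B) : ‖∫ x, v x • g x ∂μ‖ ≤ (∫ x, |v x| ∂μ) * B := by
  rw [← integral_mul_const]
  refine norm_integral_le_of_norm_le (hv.abs.mul_const B) (ae_of_all _ fun x => ?_)
  rw [norm_smul, Real.norm_eq_abs]
  exact mul_le_mul_of_nonneg_left (hB x) (abs_nonneg _)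

lemma map_integral_smul_of_bounded [CompleteSpace E] (L : E →L[ℝ] ℝ) (hv : Integrable v μ)
    {g : α → E} (hg : AEStronglyMeasurable g μ) {B : ℝ} (hB : ∀ x, ‖g x‖ ≤ B) :
    L (∫ x, v x • g x ∂μ) = ∫ x, v x * L (g x) ∂μ := by
  rw [← L.integral_comp_comm (φ := fun x => v x • g x) (hv.smul_bdd B hg (ae_of_all _ hB))]
  simp_rw [map_smul, smul_eq_mul]

end IntegralAgainstBounded

namespace IsWeakSolution

variable {n : ℕ} {s t : ℝ} {u₀ : EuclideanSpace ℝ (Fin n) → ℝ}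
  {u : ℝ → EuclideanSpace ℝ (Fin n) → ℝ}

lemma integrable_initial (hu : IsWeakSolution s u₀ u) : Integrable u₀ :=
  (hu.integrable 0 le_rfl).congr hu.initial

lemma continuousOn_integral_smul {E : Type*} [NormedAddCommGroup E] [NormedSpace ℝ E]
    (hu : IsWeakSolution s u₀ u) {g : EuclideanSpace ℝ (Fin n) → E} (hg : Continuous g) {B : ℝ}
    (hB : ∀ x, ‖g x‖ ≤ B) : ContinuousOn (fun τ => ∫ x, u τ x • g x) (Set.Ici 0) := by
  intro t ht
  have hint : ∀ τ, 0 ≤ τ → Integrable fun x => u τ x • g x := fun τ hτ =>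
    (hu.integrable τ hτ).smul_bdd B hg.aestronglyMeasurable (ae_of_all _ hB)
  rw [ContinuousWithinAt, tendsto_iff_norm_sub_tendsto_zero]
  have hL1 := (hu.continuous_L1 t ht).mul_const B
  rw [zero_mul] at hL1
  refine squeeze_zero' (Eventually.of_forall fun _ => norm_nonneg _) ?_ hL1
  filter_upwards [self_mem_nhdsWithin] with τ hτ
  rw [← integral_sub (hint τ hτ) (hint t ht)]
  simp_rw [← sub_smul]
  exact norm_integral_smul_le_of_bounded ((hu.integrable τ hτ).sub (hu.integrable t ht)) hB

lemma continuousOn_integral_abs (hu : IsWeakSolution s u₀ u) :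
    ContinuousOn (fun τ => ∫ x, |u τ x|) (Set.Ici 0) := by
  intro t ht
  rw [ContinuousWithinAt, tendsto_iff_norm_sub_tendsto_zero]
  refine squeeze_zero' (Eventually.of_forall fun _ => norm_nonneg _) ?_ (hu.continuous_L1 t ht)
  filter_upwards [self_mem_nhdsWithin] with τ hτ
  rw [← integral_sub (hu.integrable τ hτ).abs (hu.integrable t ht).abs]
  exact norm_integral_le_of_norm_le ((hu.integrable τ hτ).sub (hu.integrable t ht)).abs
    (ae_of_all _ fun x => abs_abs_sub_abs_le _ _)

lemma map_integral_smul_eq (hu : IsWeakSolution s u₀ u) (hs : 0 ≤ s) (L : ℂ →L[ℝ] ℝ)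
    {ψ : EuclideanSpace ℝ (Fin n) → ℂ} (hψ : ContDiff ℝ (⊤ : ℕ∞) ψ) (hψc : HasCompactSupport ψ)
    (hL : ∀ x, L (complexFracLaplacian s ψ x) = fracLaplacian s (fun y => L (ψ y)) x)
    (ht : 0 ≤ t) :
    L (∫ x, u t x • ψ x) = L ((∫ x, u₀ x • ψ x)
      - ∫ τ in (0 : ℝ)..t, ∫ x, u τ x • complexFracLaplacian s ψ x) := by
  have hΔ := continuous_complexFracLaplacian hs hψ hψc
  have hΔ_le : ∀ x, ‖complexFracLaplacian s ψ x‖ ≤ _ := norm_fourierInv_le _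
  have hsub : Set.uIcc 0 t ⊆ Set.Ici 0 := by
    rw [Set.uIcc_of_le ht]
    exact Set.Icc_subset_Ici_self
  obtain ⟨B, hB⟩ := hψc.exists_bound_of_continuous hψ.continuous
  have hΔmap : ∫ τ in (0 : ℝ)..t, L (∫ x, u τ x • complexFracLaplacian s ψ x)
      = ∫ τ in (0 : ℝ)..t, ∫ x, u τ x * fracLaplacian s (fun y => L (ψ y)) x :=
    intervalIntegral.integral_congr fun τ hτ => by
      simp_rw [map_integral_smul_of_bounded L (hu.integrable τ (hsub hτ)) hΔ.aestronglyMeasurable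
        hΔ_le, hL]
  have hψ_meas : AEStronglyMeasurable ψ := hψ.continuous.aestronglyMeasurable
  rw [map_sub, map_integral_smul_of_bounded L (hu.integrable t ht) hψ_meas hB,
    map_integral_smul_of_bounded L hu.integrable_initial hψ_meas hB,
    ← L.intervalIntegral_comp_comm
      ((hu.continuousOn_integral_smul hΔ hΔ_le).mono hsub).intervalIntegrable, hΔmap]
  exact hu.weak _ (L.contDiff.comp hψ) (hψc.comp_left (map_zero L)) t ht

lemma weak_complex (hu : IsWeakSolution s u₀ u) (hs : 0 ≤ s)
    {ψ : EuclideanSpace ℝ (Fin n) → ℂ} (hψ : ContDiff ℝ (⊤ : ℕ∞) ψ) (hψc : HasCompactSupport ψ)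
    (ht : 0 ≤ t) :
    ∫ x, u t x • ψ x
      = (∫ x, u₀ x • ψ x) - ∫ τ in (0 : ℝ)..t, ∫ x, u τ x • complexFracLaplacian s ψ x := by
  refine Complex.ext (hu.map_integral_smul_eq hs Complex.reCLM hψ hψc (fun x => ?_) ht)
    (hu.map_integral_smul_eq hs Complex.imCLM hψ hψc (fun x => ?_) ht) <;>
  simp [complexFracLaplacian_eq hs hψ hψc]

lemma tendsto_intervalIntegral_integral_smul {ι : Type*} {l : Filter ι} [l.IsCountablyGenerated]
    (hu : IsWeakSolution s u₀ u) (ht : 0 ≤ t) {g : ι → EuclideanSpace ℝ (Fin n) → ℂ}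
    {g' : EuclideanSpace ℝ (Fin n) → ℂ} {B : ℝ} (hg : ∀ᶠ i in l, Continuous (g i))
    (hB : ∀ᶠ i in l, ∀ x, ‖g i x‖ ≤ B) (hlim : ∀ x, Tendsto (fun i => g i x) l (𝓝 (g' x))) :
    Tendsto (fun i => ∫ τ in (0 : ℝ)..t, ∫ x, u τ x • g i x) l
      (𝓝 (∫ τ in (0 : ℝ)..t, ∫ x, u τ x • g' x)) := by
  have hIcc : Set.uIcc 0 t ⊆ Set.Ici 0 := by
    rw [Set.uIcc_of_le ht]
    exact Set.Icc_subset_Ici_self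
  have hIoc : Set.uIoc 0 t ⊆ Set.Ici 0 := Set.uIoc_subset_uIcc.trans hIcc
  refine intervalIntegral.tendsto_integral_filter_of_dominated_convergence
    (fun τ => (∫ x, |u τ x|) * B) ?_ ?_ ?_ ?_
  · filter_upwards [hg, hB] with i hgi hBi
    exact ((hu.continuousOn_integral_smul hgi hBi).mono hIoc).aestronglyMeasurable
      measurableSet_uIoc
  · filter_upwards [hB] with i hBi
    exact ae_of_all _ fun τ hτ =>
      norm_integral_smul_le_of_bounded (hu.integrable τ (hIoc hτ)) hBi
  · exact ((hu.continuousOn_integral_abs.mono hIcc).mul continuousOn_const).intervalIntegrable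
  · exact ae_of_all _ fun τ hτ => tendsto_integral_smul_of_bounded (hu.integrable τ (hIoc hτ))
      (hg.mono fun i hi => hi.aestronglyMeasurable) hB hlim

lemma integral_smul_fourierChar (hu : IsWeakSolution s u₀ u) (hs : 0 ≤ s) (ht : 0 ≤ t)
    (ξ : EuclideanSpace ℝ (Fin n)) :
    ∫ x, u t x • (𝐞 (inner ℝ x ξ) : ℂ) = (∫ x, u₀ x • (𝐞 (inner ℝ x ξ) : ℂ))
      - ∫ τ in (0 : ℝ)..t, fracSymbol s ξ • ∫ x, u τ x • (𝐞 (inner ℝ x ξ) : ℂ) := by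
  have hwave : ∀ {v : EuclideanSpace ℝ (Fin n) → ℝ}, Integrable v →
      Tendsto (fun ε => ∫ x, v x • cutWave ε ξ x) (𝓝[>] 0)
        (𝓝 (∫ x, v x • (𝐞 (inner ℝ x ξ) : ℂ))) := fun hv =>
    tendsto_integral_smul_of_bounded hv
      (Eventually.of_forall fun ε => (contDiff_cutWave ε ξ).continuous.aestronglyMeasurable)
      (Eventually.of_forall fun ε => norm_cutWave_le ε ξ) (tendsto_cutWave ξ)
  obtain ⟨B, hB⟩ := exists_norm_complexFracLaplacian_cutWave_le hs ξ
  have hcont : ∀ᶠ ε in 𝓝[>] (0 : ℝ), Continuous (complexFracLaplacian s (cutWave ε ξ)) := by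
    filter_upwards [self_mem_nhdsWithin] with ε hε
    exact continuous_complexFracLaplacian hs (contDiff_cutWave ε ξ)
      (hasCompactSupport_cutWave (Set.mem_Ioi.1 hε).ne' ξ)
  have hbound : ∀ᶠ ε in 𝓝[>] (0 : ℝ), ∀ x, ‖complexFracLaplacian s (cutWave ε ξ) x‖ ≤ B := by
    filter_upwards [Ioc_mem_nhdsGT one_pos] with ε hε using hB ε hε.1 hε.2
  have hlaplacian := hu.tendsto_intervalIntegral_integral_smul ht hcont hbound
    (tendsto_complexFracLaplacian_cutWave hs ξ)
  simp_rw [← Complex.real_smul, smul_comm _ (fracSymbol s ξ), integral_smul] at hlaplacian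
  refine tendsto_nhds_unique (hwave (hu.integrable t ht))
    (((hwave hu.integrable_initial).sub hlaplacian).congr' ?_)
  filter_upwards [self_mem_nhdsWithin] with ε hε
  exact (hu.weak_complex hs (contDiff_cutWave ε ξ)
    (hasCompactSupport_cutWave (Set.mem_Ioi.1 hε).ne' ξ) ht).symm

lemma fourier_eq (hu : IsWeakSolution s u₀ u) (hs : 0 ≤ s) (ht : 0 ≤ t)
    (ξ : EuclideanSpace ℝ (Fin n)) :
    𝓕 (fun x => (u t x : ℂ)) ξ = (heatSymbol s t ξ : ℂ) * 𝓕 (fun x => (u₀ x : ℂ)) ξ := by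
  have hfourier : ∀ v : EuclideanSpace ℝ (Fin n) → ℝ,
      𝓕 (fun x => (v x : ℂ)) ξ = ∫ x, v x • (𝐞 (inner ℝ x (-ξ)) : ℂ) := fun v => by
    simp_rw [Real.fourier_eq, Circle.smul_def, smul_eq_mul, inner_neg_right, Complex.real_smul,
      mul_comm]
  rw [hfourier, hfourier, eq_exp_smul_of_eq_sub_integral
    (y := fun τ => ∫ x, u τ x • (𝐞 (inner ℝ x (-ξ)) : ℂ)) (hu.continuousOn_integral_smul
      (by fun_prop) fun x => (Circle.norm_coe _).le)
    (fun τ hτ => hu.integral_smul_fourierChar hs hτ (-ξ)) ht, fracSymbol_neg, Complex.real_smul,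
    heatSymbol]

theorem ae_eq_heatSolution (hu : IsWeakSolution s u₀ u) (hs : 0 < s) (ht : 0 < t) :
    u t =ᵐ[volume] heatSolution s u₀ t := by
  have hfourier : 𝓕 (fun x => (u t x : ℂ))
      = fun ξ => (heatSymbol s t ξ : ℂ) * 𝓕 (fun x => (u₀ x : ℂ)) ξ :=
    funext (hu.fourier_eq hs.le ht.le)
  have hinv := ae_eq_fourierInv_fourier (f := fun x => (u t x : ℂ)) (hu.integrable t ht.le).ofReal
    (hfourier ▸ integrable_heatSymbol_mul_fourier hs ht hu.integrable_initial.ofReal)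
  filter_upwards [hinv] with x hx
  rw [hfourier, ← ofReal_heatSolution hs ht hu.integrable_initial] at hx
  exact Complex.ofReal_injective hx

end IsWeakSolution

theorem theorem3_general (n : ℕ) (hn : 1 ≤ n) :
    (∀ s : ℝ, 0 < s → s < 1 → ∃ C : ℝ, 0 < C ∧ ∀ R : ℝ, 0 < R → ∃ T : ℝ, 0 < T ∧
      ∀ u₀ : EuclideanSpace ℝ (Fin n) → ℝ, Integrable u₀ →
        (∀ᵐ y, y ∉ Metric.closedBall (0 : EuclideanSpace ℝ (Fin n)) R → u₀ y = 0) →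
        ∀ t : ℝ, T ≤ t →
          (∀ x : EuclideanSpace ℝ (Fin n), 0 < heatKernel s t x) ∧
          (∀ x, relError s (∫ y, u₀ y) t (heatSolution s u₀ t) x
              ≤ C * (∫ y, |u₀ y|) * R * t ^ (-(1 / (2 * s)))) ∧
          (0 ≤ᵐ[volume] u₀ →
            ∀ x, relError s (∫ y, u₀ y) t (heatSolution s u₀ t) x
              ≤ C * (∫ y, u₀ y) * R * t ^ (-(1 / (2 * s)))) ∧
          (∀ u : ℝ → EuclideanSpace ℝ (Fin n) → ℝ, IsWeakSolution s u₀ u →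
            ∀ᵐ x, relError s (∫ y, u₀ y) t (u t) x
              ≤ C * (∫ y, |u₀ y|) * R * t ^ (-(1 / (2 * s))))) ∧
    (∀ h : EuclideanSpace ℝ (Fin n), h ≠ 0 → ∀ t : ℝ, 0 < t → ∀ K : ℝ,
      ∃ x, K < relError 1 1 t (fun z => heatKernel 1 t (z - h)) x) ∧
    (∀ u₀ : EuclideanSpace ℝ (Fin n) → ℝ, Integrable u₀ →
      0 ≤ᵐ[volume] u₀ → 0 < ∫ y, u₀ y → ∀ t : ℝ, 0 < t → ∀ K : ℝ,
        ∃ x, K < relError 1 (∫ y, u₀ y) t (heatSolution 1 u₀ t) x) := by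
  refine ⟨fun s hs0 hs1 => ?_, fun h hh t ht K => exists_lt_relError_translate hh ht K,
    fun u₀ hu hu0 hM t ht K => exists_lt_relError_heatSolution_one hn hu hu0 hM ht K⟩
  obtain ⟨C, hC, hle⟩ := exists_relError_heatSolution_le n hs0 hs1
  refine ⟨C, hC, fun R hR => ⟨(C * R) ^ (2 * s), by positivity, fun u₀ hu hsupp t hT => ?_⟩⟩
  have ht : 0 < t := (Real.rpow_pos_of_pos (mul_pos hC hR) _).trans_le hT
  have hCR : C * R ≤ t ^ (1 / (2 * s)) := by
    rwa [one_div, Real.le_rpow_inv_iff_of_pos (by positivity) ht.le (by positivity)]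
  have hsmall : C * R * t ^ (-(1 / (2 * s))) ≤ 1 := by
    rwa [Real.rpow_neg ht.le, ← div_eq_mul_inv, div_le_one (by positivity)]
  have hbound := hle R t ht (hsmall.trans one_le_two) u₀ hu hsupp
  refine ⟨heatKernel_pos hs0 hs1 ht, hbound, fun hu0 x => ?_, fun u hw => ?_⟩
  · exact integral_congr_ae (hu0.mono fun y hy => abs_of_nonneg hy) ▸ hbound x
  · filter_upwards [hw.ae_eq_heatSolution hs0 ht] with x hx
    exact (congrArg (fun r => |r - _| / _) hx).trans_le (hbound x)

theorem theorem3 (n : ℕ) (hn : 1 ≤ n) :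
    -- fractional case: `C` depends only on `n, s`, and "large `t`" only on `n, s, R`
    (∀ s : ℝ, 0 < s → s < 1 → ∃ C : ℝ, 0 < C ∧ ∀ R : ℝ, 0 < R → ∃ T : ℝ, 0 < T ∧
      ∀ u₀ : EuclideanSpace ℝ (Fin n) → ℝ, Integrable u₀ →
        (∀ᵐ y, y ∉ Metric.closedBall (0 : EuclideanSpace ℝ (Fin n)) R → u₀ y = 0) →
        ∀ t : ℝ, T ≤ t →
          (∀ x : EuclideanSpace ℝ (Fin n), 0 < heatKernel s t x) ∧
          (∀ x, relError s (∫ y, u₀ y) t (heatSolution s u₀ t) x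
              ≤ C * (∫ y, |u₀ y|) * R * t ^ (-(1 / (2 * s)))) ∧
          (0 ≤ᵐ[volume] u₀ →
            ∀ x, relError s (∫ y, u₀ y) t (heatSolution s u₀ t) x
              ≤ C * (∫ y, u₀ y) * R * t ^ (-(1 / (2 * s)))) ∧
          (∀ u : ℝ → EuclideanSpace ℝ (Fin n) → ℝ, IsWeakSolution s u₀ u →
            ∀ᵐ x, relError s (∫ y, u₀ y) t (u t) x
              ≤ C * (∫ y, |u₀ y|) * R * t ^ (-(1 / (2 * s))))) ∧
    -- Gaussian case, datum a point mass at `h ≠ 0`: unbounded relative error at every time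
    (∀ h : EuclideanSpace ℝ (Fin n), h ≠ 0 → ∀ t : ℝ, 0 < t → ∀ K : ℝ,
      ∃ x, K < relError 1 1 t (fun z => heatKernel 1 t (z - h)) x) ∧
    -- Gaussian case, nonnegative compactly supported integrable data of positive mass
    (∀ R : ℝ, 0 < R → ∀ u₀ : EuclideanSpace ℝ (Fin n) → ℝ, Integrable u₀ →
      (∀ᵐ y, y ∉ Metric.closedBall (0 : EuclideanSpace ℝ (Fin n)) R → u₀ y = 0) →
      0 ≤ᵐ[volume] u₀ → 0 < ∫ y, u₀ y → ∀ t : ℝ, 0 < t → ∀ K : ℝ,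
        ∃ x, K < relError 1 (∫ y, u₀ y) t (heatSolution 1 u₀ t) x) := by
  obtain ⟨hfractional, htranslate, hgaussian⟩ := theorem3_general n hn
  exact ⟨hfractional, htranslate, fun _ _ u₀ hu _ => hgaussian u₀ hu⟩
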